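/- Let $S$ be a connected smooth manifold (Hausdorff, second countable, without boundary), let $g_S$ be a smooth Riemannian metric on $S$ and let $\beta : S \to (0,\infty)$ be smooth. Let $(M,g)$ be the standard static spacetime $$M=\mathbb{R}\times S,\qquad g = -\beta\,dt^2+g_S ,$$ time-oriented by $\partial_t$. Timelike and causal curves are understood to be piecewise $C^1$ and future-directed; $I^{\pm}(p)$ and $J^{\pm}(p)$ denote the chronological and causal futures and pasts. (1) $(M,g)$ is causally continuous, i.e. it is distinguishing ($I^+(p)=I^+(q)$ implies $p=q$, and $I^-(p)=I^-(q)$ implies $p=q$), and the set-valued maps $I^+$ and $I^-$ are outer continuous: for each $p\in M$ and each compact $K\subset M\setminus\overline{I^{\pm}(p)}$ one has $K\subset M\setminus\overline{I^{\pm}(q)}$ for all $q$ in some neighborhood of $p$. (2) The following are equivalent: (A) $(M,g)$ is globally hyperbolic, i.e. it is strongly causal (each point has arbitrarily small open neighborhoods which every causal curve meets in a connected set) and $J^+(p)\cap J^-(q)$ is compact for all $p,q\in M$. (B) The conformal Riemannian metric $g_S^*=g_S/\beta$ on $S$ is complete. (C) Each slice $\{t=c\}$, $c\in\mathbb{R}$,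 is a Cauchy hypersurface, i.e. it is met exactly once by every inextendible causal curve. (3) In particular, (A), (B) and (C) hold if $g_S$ is complete and $\beta$ is at most quadratic, i.e. there are $x_0\in S$, $A>0$ and a compact $K\subset S$ such that $\beta(x)\le A\,d(x_0,x)^2$ for all $x\in S\setminus K$, where $d$ is the distance of $g_S$. -/

import Mathlib

open Bundle Set Filter Topology Manifold ContinuousLinearMap
open scoped ContDiff ENNReal

noncomputable section

namespace StaticSpacetime

section pull
variable {E : Type*} [NormedAddCommGroup E] [NormedSpace ℝ E]
  {H : Type*} [TopologicalSpace H] {I : ModelWithCorners ℝ E H}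
  {M : Type*} [TopologicalSpace M] [ChartedSpace H M]
  {E' : Type*} [NormedAddCommGroup E'] [NormedSpace ℝ E']
  {H' : Type*} [TopologicalSpace H'] {I' : ModelWithCorners ℝ E' H'}
  {N : Type*} [TopologicalSpace N] [ChartedSpace H' N]

/-- The pullback `f^* b` of a field of bilinear forms: `(f^* b)_p (v, w) = b_{f p} (df_p v, df_p w)`. -/
def pullbackForm (f : M → N)
    (b : ∀ y : N, TangentSpace I' y →L[ℝ] TangentSpace I' y →L[ℝ] ℝ) (p : M) :
    TangentSpace I p →L[ℝ] TangentSpace I p →L[ℝ] ℝ :=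
  ContinuousLinearMap.precomp ℝ (mfderiv I I' f p) ∘L b (f p) ∘L mfderiv I I' f p

theorem pullbackForm_apply (f : M → N)
    (b : ∀ y : N, TangentSpace I' y →L[ℝ] TangentSpace I' y →L[ℝ] ℝ) (p : M)
    (v w : TangentSpace I p) :
    pullbackForm (I := I) f b p v w = b (f p) (mfderiv I I' f p v) (mfderiv I I' f p w) := rfl

theorem contMDiff_pullbackForm [IsManifold I ∞ M] [IsManifold I' ∞ N] {f : M → N}
    (hf : ContMDiff I I' ∞ f)
    {b : ∀ y : N, TangentSpace I' y →L[ℝ] TangentSpace I' y →L[ℝ] ℝ}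
    (hb : ContMDiff I' (I'.prod 𝓘(ℝ, E' →L[ℝ] E' →L[ℝ] ℝ)) ∞
      (fun y ↦ TotalSpace.mk' (E' →L[ℝ] E' →L[ℝ] ℝ)
        (E := fun y : N ↦ TangentSpace I' y →L[ℝ] TangentSpace I' y →L[ℝ] ℝ) y (b y))) :
    ContMDiff I (I.prod 𝓘(ℝ, E →L[ℝ] E →L[ℝ] ℝ)) ∞
      (fun p ↦ TotalSpace.mk' (E →L[ℝ] E →L[ℝ] ℝ)
        (E := fun p : M ↦ TangentSpace I p →L[ℝ] TangentSpace I p →L[ℝ] ℝ) p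
        (pullbackForm (I := I) f b p)) := by
  intro p₀
  rw [contMDiffAt_hom_bundle]
  refine ⟨contMDiffAt_id, ?_⟩
  have hL := (hf p₀).mfderiv_const (m := ∞) (n := ∞) (by simp)
  have hB := ((contMDiffAt_hom_bundle _).1 (hb (f p₀))).2.comp p₀ (hf p₀)
  have h1 := (hB.clm_comp hL)
  have h2 := (hL.clm_precomp (F₃ := ℝ)).clm_comp h1
  refine h2.congr_of_eventuallyEq ?_
  have e1 : ∀ᶠ p in 𝓝 p₀, p ∈ (trivializationAt E (TangentSpace I : M → Type _) p₀).baseSet :=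
    (trivializationAt E (TangentSpace I : M → Type _) p₀).open_baseSet.mem_nhds
      (FiberBundle.mem_baseSet_trivializationAt' p₀)
  have e2 : ∀ᶠ p in 𝓝 p₀,
      f p ∈ (trivializationAt E' (TangentSpace I' : N → Type _) (f p₀)).baseSet :=
    (hf p₀).continuousAt.eventually
    ((trivializationAt E' (TangentSpace I' : N → Type _) (f p₀)).open_baseSet.mem_nhds
      (FiberBundle.mem_baseSet_trivializationAt' (f p₀)))
  filter_upwards [e1, e2] with p h1 h2
  ext v w
  have key : ∀ u, (trivializationAt E' (TangentSpace I' : N → Type _) (f p₀)).symm (f p)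
      (inCoordinates E (TangentSpace I) E' (TangentSpace I') p₀ p (f p₀) (f p)
        (mfderiv I I' f p) u) =
      mfderiv I I' f p ((trivializationAt E (TangentSpace I : M → Type _) p₀).symm p u) := by
    intro u
    rw [inCoordinates_eq h1 h2]
    simp [Trivialization.symm_apply_apply_mk _ h2]
  change inCoordinates E (TangentSpace I) (E →L[ℝ] ℝ) (fun y ↦ TangentSpace I y →L[ℝ] ℝ)
      p₀ p p₀ p (pullbackForm (I := I) f b p) v w =
    inCoordinates E' (TangentSpace I') (E' →L[ℝ] ℝ) (fun y ↦ TangentSpace I' y →L[ℝ] ℝ)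
      (f p₀) (f p) (f p₀) (f p) (b (f p))
      (inCoordinates E (TangentSpace I) E' (TangentSpace I') p₀ p (f p₀) (f p)
        (mfderiv I I' f p) v)
      (inCoordinates E (TangentSpace I) E' (TangentSpace I') p₀ p (f p₀) (f p)
        (mfderiv I I' f p) w)
  rw [inCoordinates_apply_eq₂ h1 h1 (Set.mem_univ _),
    inCoordinates_apply_eq₂ h2 h2 (Set.mem_univ _), key, key, pullbackForm_apply]
  simp
end pull

section lorentz

variable {E : Type*} [NormedAddCommGroup E] [NormedSpace ℝ E]
  {H : Type*} [TopologicalSpace H] (I : ModelWithCorners ℝ E H)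
  (M : Type*) [TopologicalSpace M] [ChartedSpace H M] [IsManifold I ∞ M]

/-- A smooth Lorentzian metric, of signature `(-, +, …, +)`, on a manifold. The signature
condition says that at each point there is a timelike vector on whose orthogonal complement the
form is positive definite. -/
structure LorentzianMetric where
  /-- The bilinear form on each tangent space. -/
  inner (p : M) : TangentSpace I p →L[ℝ] TangentSpace I p →L[ℝ] ℝ
  symm (p : M) (v w : TangentSpace I p) : inner p v w = inner p w v
  signature (p : M) : ∃ u : TangentSpace I p, inner p u u < 0 ∧
    ∀ w : TangentSpace I p, inner p u w = 0 → w ≠ 0 → 0 < inner p w w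
  contMDiff : ContMDiff I (I.prod 𝓘(ℝ, E →L[ℝ] E →L[ℝ] ℝ)) ∞
    (fun p ↦ TotalSpace.mk' (E →L[ℝ] E →L[ℝ] ℝ)
      (E := fun p : M ↦ TangentSpace I p →L[ℝ] TangentSpace I p →L[ℝ] ℝ) p (inner p))

/-- A time-oriented Lorentzian manifold; the time orientation is given by a smooth timelike
vector field, declared to be future-directed. -/
structure Spacetime extends LorentzianMetric I M where
  /-- The time-orienting vector field. -/
  timeField (p : M) : TangentSpace I p
  timeField_timelike (p : M) : inner p (timeField p) (timeField p) < 0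
  timeField_contMDiff : ContMDiff I (I.prod 𝓘(ℝ, E)) ∞
    (fun p ↦ TotalSpace.mk' E (E := fun p : M ↦ TangentSpace I p) p (timeField p))

end lorentz

namespace Spacetime

variable {E : Type*} [NormedAddCommGroup E] [NormedSpace ℝ E]
  {H : Type*} [TopologicalSpace H] {I : ModelWithCorners ℝ E H}
  {M : Type*} [TopologicalSpace M] [ChartedSpace H M] [IsManifold I ∞ M]

/-- Future-directed timelike tangent vectors. -/
def FutureTimelike (𝒮 : Spacetime I M) (p : M) (v : TangentSpace I p) : Prop :=
  𝒮.inner p v v < 0 ∧ 𝒮.inner p (𝒮.timeField p) v < 0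

/-- Future-directed causal (nonspacelike) tangent vectors. -/
def FutureCausal (𝒮 : Spacetime I M) (p : M) (v : TangentSpace I p) : Prop :=
  v ≠ 0 ∧ 𝒮.inner p v v ≤ 0 ∧ 𝒮.inner p (𝒮.timeField p) v < 0

/-- `γ`, restricted to the interval `J`, is a piecewise `C^1` curve whose velocities all satisfy
`C`. The set `D` contains the break points, finitely many in each compact subinterval of `J`; on
each compact subinterval of `J` without break points in its interior, `γ` is `C^1` up to the
endpoints, and the velocities (one-sided at the endpoints) satisfy `C`. -/
def IsPiecewiseCurve (C : ∀ p : M, TangentSpace I p → Prop) (γ : ℝ → M) (J : Set ℝ) : Prop :=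
  J.OrdConnected ∧ ContinuousOn γ J ∧ ∃ D : Set ℝ,
    (∀ c ∈ J, ∀ d ∈ J, (D ∩ Icc c d).Finite) ∧
    ∀ c ∈ J, ∀ d ∈ J, c < d → Disjoint D (Ioo c d) →
      ContMDiffOn 𝓘(ℝ, ℝ) I 1 γ (Icc c d) ∧
      ∀ s ∈ Icc c d, C (γ s) (mfderivWithin 𝓘(ℝ, ℝ) I γ (Icc c d) s (1 : ℝ))

/-- Future-directed timelike curves defined on an interval `J`. -/
def IsTimelikeCurve (𝒮 : Spacetime I M) (γ : ℝ → M) (J : Set ℝ) : Prop :=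
  IsPiecewiseCurve 𝒮.FutureTimelike γ J

/-- Future-directed causal curves defined on an interval `J`. -/
def IsCausalCurve (𝒮 : Spacetime I M) (γ : ℝ → M) (J : Set ℝ) : Prop :=
  IsPiecewiseCurve 𝒮.FutureCausal γ J

/-- The chronological relation `p ≪ q`. -/
def Chronological (𝒮 : Spacetime I M) (p q : M) : Prop :=
  ∃ (γ : ℝ → M) (a b : ℝ), a < b ∧ 𝒮.IsTimelikeCurve γ (Icc a b) ∧ γ a = p ∧ γ b = q

/-- The causal relation `p ≤ q`. -/
def Causal (𝒮 : Spacetime I M) (p q : M) : Prop :=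
  p = q ∨ ∃ (γ : ℝ → M) (a b : ℝ), a < b ∧ 𝒮.IsCausalCurve γ (Icc a b) ∧ γ a = p ∧ γ b = q

/-- The chronological future `I⁺(p)`. -/
def chronFuture (𝒮 : Spacetime I M) (p : M) : Set M := {q | 𝒮.Chronological p q}

/-- The chronological past `I⁻(p)`. -/
def chronPast (𝒮 : Spacetime I M) (p : M) : Set M := {q | 𝒮.Chronological q p}

/-- The causal future `J⁺(p)`. -/
def causalFuture (𝒮 : Spacetime I M) (p : M) : Set M := {q | 𝒮.Causal p q}

/-- The causal past `J⁻(p)`. -/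
def causalPast (𝒮 : Spacetime I M) (p : M) : Set M := {q | 𝒮.Causal q p}

/-- Distinct points have distinct chronological futures and distinct chronological pasts. -/
def IsDistinguishing (𝒮 : Spacetime I M) : Prop :=
  (∀ p q, 𝒮.chronFuture p = 𝒮.chronFuture q → p = q) ∧
  (∀ p q, 𝒮.chronPast p = 𝒮.chronPast q → p = q)

/-- A set-valued map `F` is outer continuous if, for each `p`, each compact set in the exterior
of `F p` is in the exterior of `F q` for all `q` close to `p`. -/
def OuterContinuous (F : M → Set M) : Prop :=
  ∀ p, ∀ K : Set M, IsCompact K → K ⊆ (closure (F p))ᶜ → ∀ᶠ q in 𝓝 p, K ⊆ (closure (F q))ᶜ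

/-- Causal continuity: the spacetime is distinguishing and the set-valued maps `I⁺` and `I⁻` are
outer continuous. -/
def IsCausallyContinuous (𝒮 : Spacetime I M) : Prop :=
  𝒮.IsDistinguishing ∧ OuterContinuous 𝒮.chronFuture ∧ OuterContinuous 𝒮.chronPast

/-- An open set is causally convex if every causal curve meets it in a connected set of
parameters. -/
def IsCausallyConvex (𝒮 : Spacetime I M) (U : Set M) : Prop :=
  IsOpen U ∧ ∀ (γ : ℝ → M) (J : Set ℝ), 𝒮.IsCausalCurve γ J → (J ∩ γ ⁻¹' U).OrdConnected

/-- Strong causality: every point has arbitrarily small causally convex neighborhoods. -/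
def IsStronglyCausal (𝒮 : Spacetime I M) : Prop :=
  ∀ p, ∀ V ∈ 𝓝 p, ∃ U ⊆ V, p ∈ U ∧ 𝒮.IsCausallyConvex U

/-- Global hyperbolicity: strong causality, and compactness of all `J⁺(p) ∩ J⁻(q)`. -/
def IsGloballyHyperbolic (𝒮 : Spacetime I M) : Prop :=
  𝒮.IsStronglyCausal ∧ ∀ p q, IsCompact (𝒮.causalFuture p ∩ 𝒮.causalPast q)

/-- A causal curve on an interval `J` is inextendible if it has neither a future nor a past
endpoint. The filters `atTop` and `atBot` are those of the ordered type `J`, so that they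
describe the approach to the right and to the left end of `J`. -/
def IsInextendibleCausalCurve (𝒮 : Spacetime I M) (γ : ℝ → M) (J : Set ℝ) : Prop :=
  𝒮.IsCausalCurve γ J ∧
  (∀ p, ¬ Tendsto (fun s : J ↦ γ s) atTop (𝓝 p)) ∧
  (∀ p, ¬ Tendsto (fun s : J ↦ γ s) atBot (𝓝 p))

/-- A Cauchy hypersurface is a subset which every inextendible causal curve meets exactly once. -/
def IsCauchyHypersurface (𝒮 : Spacetime I M) (A : Set M) : Prop :=
  ∀ (γ : ℝ → M) (J : Set ℝ), 𝒮.IsInextendibleCausalCurve γ J → ∃! s, s ∈ J ∧ γ s ∈ A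

end Spacetime

section static

variable {E : Type*} [NormedAddCommGroup E] [NormedSpace ℝ E]
  {H : Type*} [TopologicalSpace H] {I : ModelWithCorners ℝ E H}
  {S : Type*} [TopologicalSpace S] [ChartedSpace H S]

/-- The vector field `∂_t` on `ℝ × S`. -/
def partialT (p : ℝ × S) : TangentSpace (𝓘(ℝ, ℝ).prod I) p :=
  mfderiv 𝓘(ℝ, ℝ) (𝓘(ℝ, ℝ).prod I) (fun s : ℝ ↦ (s, p.2)) p.1 (1 : ℝ)

theorem partialT_eq (p : ℝ × S) : partialT (I := I) p = ((1 : ℝ), (0 : E)) := by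
  rw [partialT, mfderiv_prod_left]
  rfl

variable [IsManifold I ∞ S]

variable (I S) in
/-- Smooth Riemannian metrics on the manifold `S`. -/
abbrev SmoothRiemannianMetric :=
  ContMDiffRiemannianMetric I ∞ E (fun x : S ↦ TangentSpace I x)

/-- The Riemannian distance of the metric `g`: the infimum of the `g`-lengths of `C^1` paths. -/
def riemannianDist (g : SmoothRiemannianMetric I S) (x y : S) : ℝ≥0∞ :=
  letI : RiemannianBundle (fun x : S ↦ TangentSpace I x) := ⟨g.toRiemannianMetric⟩
  riemannianEDist I x y

/-- Completeness of a Riemannian metric: every Cauchy sequence for its distance converges. -/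
def IsCompleteMetric (g : SmoothRiemannianMetric I S) : Prop :=
  ∀ u : ℕ → S,
    (∀ ε : ℝ≥0∞, 0 < ε → ∃ N, ∀ m ≥ N, ∀ n ≥ N, riemannianDist g (u m) (u n) < ε) →
    ∃ x, Tendsto u atTop (𝓝 x)

/-- `V` behaves at most quadratically at infinity: `V x ≤ A d(x₀, x)²` outside a compact set, for
some point `x₀` and some constant `A > 0`. -/
def AtMostQuadratic (g : SmoothRiemannianMetric I S) (V : S → ℝ) : Prop :=
  ∃ (x₀ : S) (A : ℝ) (K : Set S), 0 < A ∧ IsCompact K ∧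
    ∀ x ∉ K, V x ≤ A * (riemannianDist g x₀ x).toReal ^ 2

/-- The conformal metric `g / β`. -/
def conformalMetric (g : SmoothRiemannianMetric I S) (β : S → ℝ)
    (hβ : ContMDiff I 𝓘(ℝ, ℝ) ∞ β) (hpos : ∀ x, 0 < β x) : SmoothRiemannianMetric I S where
  inner x := (β x)⁻¹ • g.inner x
  symm x v w := by simp [g.symm x v w]
  pos x v hv := by
    have := mul_pos (inv_pos.2 (hpos x)) (g.pos x v hv)
    simpa using this
  isVonNBounded x := by
    have hs : 0 < √(β x) := Real.sqrt_pos.2 (hpos x)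
    refine ((g.isVonNBounded x).image
      (√(β x) • ContinuousLinearMap.id ℝ (TangentSpace I x))).subset ?_
    intro v hv
    refine ⟨(√(β x))⁻¹ • v, ?_, ?_⟩
    · have hv' : (β x)⁻¹ * g.inner x v v < 1 := by simpa using hv
      have h2 : (√(β x))⁻¹ * (√(β x))⁻¹ = (β x)⁻¹ := by
        rw [← mul_inv, Real.mul_self_sqrt (hpos x).le]
      simpa [← mul_assoc, h2] using hv'
    · simp [smul_smul, hs.ne']
  contMDiff := by
    have h : ContMDiff I 𝓘(ℝ, ℝ) ∞ (fun x ↦ (β x)⁻¹) := hβ.inv₀ fun x ↦ (hpos x).ne'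
    exact h.smul_section g.contMDiff

/-- The form `-β dt² + g_S` on `ℝ × S`, where `dt²` is the pullback of the standard metric of `ℝ`
and `g_S` is understood to be pulled back by the projection to `S`. -/
def staticForm (g : SmoothRiemannianMetric I S) (β : S → ℝ) (p : ℝ × S) :
    TangentSpace (𝓘(ℝ, ℝ).prod I) p →L[ℝ] TangentSpace (𝓘(ℝ, ℝ).prod I) p →L[ℝ] ℝ :=
  (-β p.2) • pullbackForm Prod.fst (riemannianMetricVectorSpace ℝ).inner p +
    pullbackForm Prod.snd g.inner p

theorem staticForm_apply (g : SmoothRiemannianMetric I S) (β : S → ℝ) (p : ℝ × S)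
    (v w : TangentSpace (𝓘(ℝ, ℝ).prod I) p) :
    staticForm g β p v w = -β p.2 * (v.1 * w.1) + g.inner p.2 v.2 w.2 := by
  have h1 : pullbackForm Prod.fst (riemannianMetricVectorSpace ℝ).inner p v w = v.1 * w.1 := by
    rw [pullbackForm_apply, mfderiv_fst]
    exact mul_comm _ _
  have h2 : pullbackForm Prod.snd g.inner p v w = g.inner p.2 v.2 w.2 := by
    rw [pullbackForm_apply, mfderiv_snd]
    rfl
  rw [← h1, ← h2]
  rfl

theorem staticForm_partialT (g : SmoothRiemannianMetric I S) (β : S → ℝ) (p : ℝ × S)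
    (w : TangentSpace (𝓘(ℝ, ℝ).prod I) p) :
    staticForm g β p (partialT p) w = -β p.2 * w.1 := by
  rw [staticForm_apply, partialT_eq]
  have h : g.inner p.2 (0 : E) w.2 = 0 :=
    congrArg (fun l : TangentSpace I p.2 →L[ℝ] ℝ ↦ l w.2) (g.inner p.2).map_zero
  refine (congrArg₂ (· + ·) (congrArg (-β p.2 * ·) (one_mul (w.1 : ℝ))) h).trans (add_zero _)

/-- The standard static spacetime `(ℝ × S, -β dt² + g_S)`, time-oriented by `∂_t`. -/
def standardStatic (g : SmoothRiemannianMetric I S) (β : S → ℝ)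
    (hβ : ContMDiff I 𝓘(ℝ, ℝ) ∞ β) (hpos : ∀ x, 0 < β x) :
    Spacetime (𝓘(ℝ, ℝ).prod I) (ℝ × S) where
  inner := staticForm g β
  symm p v w := by
    rw [staticForm_apply, staticForm_apply]
    exact congrArg₂ (· + ·) (congrArg (-β p.2 * ·) (mul_comm (v.1 : ℝ) w.1)) (g.symm p.2 v.2 w.2)
  signature p := by
    refine ⟨partialT p, ?_, fun w hw hw0 ↦ ?_⟩
    · rw [staticForm_partialT, partialT_eq]
      simpa using hpos p.2
    · rw [staticForm_partialT] at hw
      have h1 : (w.1 : ℝ) = 0 := (mul_eq_zero.1 hw).resolve_left (neg_ne_zero.2 (hpos p.2).ne')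
      have h2 : (w.2 : E) ≠ 0 := fun h ↦ hw0 (Prod.ext h1 h)
      rw [staticForm_apply]
      have h3 : -β p.2 * ((w.1 : ℝ) * w.1) = 0 := by rw [h1]; simp
      exact (g.pos p.2 w.2 h2).trans_eq ((zero_add _).symm.trans (congrArg (· + _) h3.symm))
  contMDiff := by
    have h1 := contMDiff_pullbackForm (I := 𝓘(ℝ, ℝ).prod I) (f := (Prod.fst : ℝ × S → ℝ))
      contMDiff_fst ((riemannianMetricVectorSpace ℝ).contMDiff.of_le le_top)
    have h2 := contMDiff_pullbackForm (I := 𝓘(ℝ, ℝ).prod I) (f := (Prod.snd : ℝ × S → S))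
      contMDiff_snd g.contMDiff
    have h3 : ContMDiff (𝓘(ℝ, ℝ).prod I) 𝓘(ℝ, ℝ) ∞ (fun p : ℝ × S ↦ -β p.2) :=
      (hβ.comp contMDiff_snd).neg
    exact (h3.smul_section h1).add_section h2
  timeField := partialT
  timeField_timelike p := by
    rw [staticForm_partialT, partialT_eq]
    simpa using hpos p.2
  timeField_contMDiff := by
    have h1 : ContMDiff 𝓘(ℝ, ℝ) (𝓘(ℝ, ℝ).prod 𝓘(ℝ, ℝ)) ∞
        (fun t : ℝ ↦ TotalSpace.mk' ℝ (E := fun t : ℝ ↦ TangentSpace 𝓘(ℝ, ℝ) t) t (1 : ℝ)) := by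
      exact contMDiff_vectorSpace_iff_contDiff.2 (contDiff_const (c := (1 : ℝ)))
    have h2 : ContMDiff I (I.prod 𝓘(ℝ, E)) ∞
        (zeroSection E (fun x : S ↦ TangentSpace I x)) := contMDiff_zeroSection _ _
    have h3 := (contMDiff_equivTangentBundleProd_symm (I := 𝓘(ℝ, ℝ)) (I' := I) (M := ℝ) (M' := S)
      (n := ∞)).comp ((h1.comp contMDiff_fst).prodMk (h2.comp contMDiff_snd))
    refine h3.congr fun p ↦ ?_
    rw [partialT_eq]
    rfl

end static

end StaticSpacetime

end

open StaticSpacetime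

/-! Let `d` be the distance of `g_S / β`. A curve `(t, x)` is future causal when `t' > 0` and `|x'|
≤ t'` in the norm of `g_S / β`, and future timelike when `|x'| < t'`. Integration gives `p ≪ q ↔
d(p.2, q.2) < q.1 - p.1` (`chronological_iff`), and `p ≤ q` implies the weak inequality. Everything
is then read off from the function `d`.

Causal continuity needs only that `d` is a continuous metric: the closure of `I⁺(p)` is the set
where the weak inequality holds. Strong causality holds because the balls of `d + |t|` are causally
convex.

(A) → (B): the tail of a `d`-Cauchy sequence, placed at time `0`, lies in one compact causal
diamond. (B) → (C): if `t` were bounded towards an end of an inextendible causal curve, its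
component in `S` would be Cauchy at that end, and the curve would have an endpoint. (C) → (B): a
Cauchy sequence without limit yields a curve of finite length without endpoint, whose timelike lift
stays below some slice.

(B) → (A) is the substantial part. By the Hopf–Rinow argument (`HasShortPaths.isCompact_closedBall`)
closed balls are compact, so it suffices that `J⁺(p)` contains every `q` with `d(p.2, q.2) ≤ q.1 -
p.1`. In the case of equality a minimizing path is lifted to a null curve, and it must be shown to
be piecewise `C^1`. No geodesic equation is used: the path is a limit of almost minimizing ones
(`HasShortPaths.exists_isometric_path`), in a chart its second differences are `O(k^(3/2))` by the
parallelogram law (`ChartBounds.exists_second_difference_le`), and such a function is `C^1`.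

(3): by a Gronwall estimate, `d`-bounded sets are bounded for the distance of `g_S` when `β` is at
most quadratic. A `d`-Cauchy sequence therefore has its tail in a compact `g_S`-ball. -/

namespace StaticSpacetime

/-! ### Hopf–Rinow theory in metric spaces with almost minimizing paths -/

section metric

/-- A metric space in which the distance of two points is the infimum of the lengths of the
continuous paths joining them, the lengths being tested on two intermediate points. -/
def HasShortPaths (X : Type*) [MetricSpace X] : Prop :=
  ∀ x y : X, ∀ ε > 0, ∃ f : ℝ → X, ContinuousOn f (Icc 0 1) ∧ f 0 = x ∧ f 1 = y ∧
    ∀ s t, 0 ≤ s → s ≤ t → t ≤ 1 →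
      dist x (f s) + dist (f s) (f t) + dist (f t) y ≤ dist x y + ε

variable {X : Type*} [MetricSpace X]

theorem HasShortPaths.exists_between (h : HasShortPaths X) (x y : X) {s ε : ℝ} (hs : 0 ≤ s)
    (hs' : s ≤ dist x y) (hε : 0 < ε) :
    ∃ z, dist x z = s ∧ dist z y ≤ dist x y - s + ε := by
  obtain ⟨f, hf, f0, f1, hd⟩ := h x y ε hε
  have hc : ContinuousOn (fun τ ↦ dist x (f τ)) (Icc 0 1) := by fun_prop
  have := intermediate_value_Icc zero_le_one hc
  simp only [f0, f1, dist_self] at this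
  obtain ⟨τ, hτ, hτs⟩ := this ⟨hs, hs'⟩
  have := hd τ τ hτ.1 le_rfl hτ.2
  simp only [dist_self] at this hτs
  exact ⟨f τ, hτs, by linarith⟩

/-- The Hopf–Rinow–Cohn-Vossen argument. If some ball fails to be compact, let `R` be the supremum
of the radii of compact balls. The ball of radius `R` is approximated by smaller compact ones, hence
totally bounded and compact; local compactness then thickens it beyond `R`. -/
theorem HasShortPaths.isCompact_closedBall [CompleteSpace X] [WeaklyLocallyCompactSpace X]
    (h : HasShortPaths X) (x : X) (r : ℝ) : IsCompact (Metric.closedBall x r) := by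
  have mono : ∀ {r r' : ℝ}, r ≤ r' → IsCompact (Metric.closedBall x r') →
      IsCompact (Metric.closedBall x r) := fun hr hc ↦
    hc.of_isClosed_subset Metric.isClosed_closedBall (Metric.closedBall_subset_closedBall hr)
  by_contra hr
  have hbdd : ∀ r' ∈ {r' | IsCompact (Metric.closedBall x r')}, r' ≤ r := fun r' hr' ↦
    le_of_not_ge fun h' ↦ hr (mono h' hr')
  have h0 : IsCompact (Metric.closedBall x 0) := by simp
  set R := sSup {r' | IsCompact (Metric.closedBall x r')} with hR
  have hB : BddAbove {r' | IsCompact (Metric.closedBall x r')} := ⟨r, hbdd⟩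
  have hR0 : 0 ≤ R := le_csSup hB h0
  have hlt : ∀ r' < R, IsCompact (Metric.closedBall x r') := fun r' hr' ↦ by
    obtain ⟨r'', h1, h2⟩ := exists_lt_of_lt_csSup ⟨0, h0⟩ hr'
    exact mono h2.le h1
  have hRc : IsCompact (Metric.closedBall x R) := by
    refine TotallyBounded.isCompact_of_isClosed ?_ Metric.isClosed_closedBall
    rw [Metric.totallyBounded_iff]
    intro ε hε
    have hc : IsCompact (Metric.closedBall x (max 0 (R - ε / 3))) := by
      rcases le_total (R - ε / 3) 0 with h' | h'
      · rwa [max_eq_left h']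
      · rw [max_eq_right h']; exact hlt _ (by linarith)
    obtain ⟨t, ht, htc⟩ := Metric.totallyBounded_iff.1 hc.totallyBounded (ε / 3) (by positivity)
    refine ⟨t, ht, fun y hy ↦ ?_⟩
    rw [Metric.mem_closedBall, dist_comm] at hy
    -- Move `y` back along a short path into the smaller compact ball: this costs at most `2ε/3`,
    -- and the net of that ball costs less than `ε/3`.
    obtain ⟨z, hz, hzy⟩ := h.exists_between x y (s := min (dist x y) (max 0 (R - ε / 3)))
      (le_min dist_nonneg (le_max_left _ _)) (min_le_left _ _) (ε := ε / 3) (by positivity)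
    have hz' : z ∈ Metric.closedBall x (max 0 (R - ε / 3)) := by
      rw [Metric.mem_closedBall, dist_comm, hz]; exact min_le_right _ _
    obtain ⟨w, hw, hzw⟩ := mem_iUnion₂.1 (htc hz')
    refine mem_iUnion₂.2 ⟨w, hw, ?_⟩
    rw [Metric.mem_ball] at hzw ⊢
    have h1 : dist x y - ε / 3 ≤ min (dist x y) (max 0 (R - ε / 3)) :=
      le_min (by linarith) (le_max_of_le_right (by linarith))
    have := dist_triangle y z w
    rw [dist_comm y z] at this
    linarith
  obtain ⟨K, hK, hKs⟩ := exists_compact_superset hRc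
  obtain ⟨δ, hδ, hδK⟩ := hRc.exists_cthickening_subset_open isOpen_interior hKs
  have : IsCompact (Metric.closedBall x (R + δ / 2)) := by
    refine hK.of_isClosed_subset Metric.isClosed_closedBall fun y hy ↦
      interior_subset (hδK ?_)
    rw [Metric.mem_closedBall, dist_comm] at hy
    obtain ⟨z, hz, hzy⟩ := h.exists_between x y (s := min (dist x y) R)
      (le_min dist_nonneg hR0) (min_le_left _ _) (ε := δ / 2) (by positivity)
    refine Metric.mem_cthickening_of_dist_le y z δ _ ?_ ?_
    · rw [Metric.mem_closedBall, dist_comm, hz]; exact min_le_right _ _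
    · have h1 : dist x y - δ / 2 ≤ min (dist x y) R := le_min (by linarith) (by linarith)
      rw [dist_comm]; linarith
  have := le_csSup hB this
  linarith

/-- Almost minimizing paths, parametrized by the distance from `x`, converge pointwise along an
ultrafilter because they stay in a compact ball. The approximants need not be continuous: an
additive error tending to `0` already makes the limit 1-Lipschitz, and the triangle inequality
through `x` and `y` upgrades this to an isometry. -/
theorem HasShortPaths.exists_isometric_path (h : HasShortPaths X) (x y : X)
    (hc : IsCompact (Metric.closedBall x (dist x y))) :
    ∃ σ : ℝ → X, σ 0 = x ∧ σ (dist x y) = y ∧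
      ∀ s t, 0 ≤ s → s ≤ t → t ≤ dist x y → dist (σ s) (σ t) = t - s := by
  set L := dist x y with hL
  have key : ∀ k : ℕ, ∃ q : ℝ → X, (∀ s ∈ Icc 0 L, dist x (q s) = s) ∧
      (∀ s t, 0 ≤ s → s ≤ t → t ≤ L → dist (q s) (q t) ≤ t - s + 1 / ((k : ℝ) + 1)) ∧
      dist (q L) y ≤ 1 / ((k : ℝ) + 1) := by
    intro k
    obtain ⟨f, hf, f0, f1, hd⟩ := h x y (1 / ((k : ℝ) + 1)) (by positivity)
    have hcont : ContinuousOn (fun τ ↦ dist x (f τ)) (Icc 0 1) := by fun_prop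
    have hiv : ∀ b ∈ Icc (0 : ℝ) 1, ∀ s ∈ Icc 0 (dist x (f b)),
        ∃ τ ∈ Icc 0 b, dist x (f τ) = s := by
      intro b hb s hs
      have := intermediate_value_Icc hb.1 (hcont.mono (Icc_subset_Icc_right hb.2))
      simp only [f0, dist_self] at this
      exact this hs
    -- The parameters at distance `s` from `x`. Taking the first one makes the choice monotone in
    -- `s`, as the bound on `f` requires.
    let Z : ℝ → Set ℝ := fun s ↦ Icc 0 1 ∩ (fun τ ↦ dist x (f τ)) ⁻¹' {s}
    have hZc : ∀ s, IsCompact (Z s) := fun s ↦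
      isCompact_Icc.of_isClosed_subset
        (hcont.preimage_isClosed_of_isClosed isClosed_Icc isClosed_singleton) inter_subset_left
    have hZne : ∀ s ∈ Icc 0 L, (Z s).Nonempty := by
      intro s hs
      obtain ⟨τ, h1, h2⟩ := hiv 1 (by simp) s (by rwa [f1])
      exact ⟨τ, h1, h2⟩
    have hmem : ∀ s ∈ Icc 0 L, sInf (Z s) ∈ Z s := fun s hs ↦ (hZc s).sInf_mem (hZne s hs)
    have hdist : ∀ s ∈ Icc 0 L, dist x (f (sInf (Z s))) = s := fun s hs ↦ (hmem s hs).2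
    have hlast : ∀ s t, 0 ≤ s → s ≤ t → t ≤ L → sInf (Z s) ≤ sInf (Z t) := by
      intro s t hs hst ht
      have h1 := hmem t ⟨hs.trans hst, ht⟩
      obtain ⟨τ, h2, h3⟩ := hiv _ h1.1 s ⟨hs, by rw [hdist t ⟨hs.trans hst, ht⟩]; exact hst⟩
      exact (csInf_le (hZc s).bddBelow ⟨⟨h2.1, h2.2.trans h1.1.2⟩, h3⟩).trans h2.2
    refine ⟨fun s ↦ f (sInf (Z s)), hdist, fun s t hs hst ht ↦ ?_, ?_⟩
    · have h1 := hd _ _ (hmem s ⟨hs, hst.trans ht⟩).1.1 (hlast s t hs hst ht)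
        (hmem t ⟨hs.trans hst, ht⟩).1.2
      rw [hdist s ⟨hs, hst.trans ht⟩] at h1
      have h2 := dist_triangle x (f (sInf (Z t))) y
      rw [hdist t ⟨hs.trans hst, ht⟩] at h2
      dsimp only
      linarith
    · have hL' : L ∈ Icc 0 L := ⟨dist_nonneg, le_rfl⟩
      have h1 := hd _ _ (hmem L hL').1.1 le_rfl (hmem L hL').1.2
      rw [hdist L hL', dist_self] at h1
      dsimp only
      linarith
  choose q hq1 hq2 hq3 using key
  have hlim : ∀ s : ℝ, ∃ z, s ∈ Icc 0 L → Tendsto (fun k ↦ q k s) (hyperfilter ℕ) (𝓝 z) := by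
    intro s
    by_cases hs : s ∈ Icc 0 L
    · obtain ⟨z, -, hz⟩ := hc.ultrafilter_le_nhds ((hyperfilter ℕ).map fun k ↦ q k s) (by
        rw [le_principal_iff]
        refine Filter.mem_map.2 (univ_mem' fun k ↦ ?_)
        rw [mem_preimage, Metric.mem_closedBall, dist_comm, hq1 k s hs]
        exact hs.2)
      exact ⟨z, fun _ ↦ hz⟩
    · exact ⟨x, fun h ↦ absurd h hs⟩
  choose σ hσ using hlim
  have hε : Tendsto (fun k : ℕ ↦ 1 / ((k : ℝ) + 1)) (hyperfilter ℕ) (𝓝 0) :=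
    tendsto_one_div_add_atTop_nhds_zero_nat.mono_left Nat.hyperfilter_le_atTop
  have hL0 : 0 ≤ L := dist_nonneg
  have h0 : σ 0 = x := by
    have h1 : Tendsto (fun k ↦ dist x (q k 0)) (hyperfilter ℕ) (𝓝 (dist x (σ 0))) :=
      tendsto_const_nhds.dist (hσ 0 ⟨le_rfl, hL0⟩)
    simp only [fun k ↦ hq1 k 0 ⟨le_rfl, hL0⟩] at h1
    exact (dist_eq_zero.1 (tendsto_nhds_unique h1 tendsto_const_nhds)).symm
  have h1 : σ L = y := by
    have h1 : Tendsto (fun k ↦ dist (q k L) y) (hyperfilter ℕ) (𝓝 (dist (σ L) y)) :=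
      (hσ L ⟨hL0, le_rfl⟩).dist tendsto_const_nhds
    exact dist_le_zero.1 (le_of_tendsto_of_tendsto' h1 hε hq3)
  have hle : ∀ s t, 0 ≤ s → s ≤ t → t ≤ L → dist (σ s) (σ t) ≤ t - s := by
    intro s t hs hst ht
    have h2 := (hσ s ⟨hs, hst.trans ht⟩).dist (hσ t ⟨hs.trans hst, ht⟩)
    have h3 := hε.const_add (t - s)
    rw [add_zero] at h3
    exact le_of_tendsto_of_tendsto' h2 h3 fun k ↦ hq2 k s t hs hst ht
  refine ⟨σ, h0, h1, fun s t hs hst ht ↦ (hle s t hs hst ht).antisymm ?_⟩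
  have e1 := hle 0 s le_rfl hs (hst.trans ht)
  have e2 := hle t L (hs.trans hst) ht le_rfl
  rw [h0] at e1
  rw [h1] at e2
  have := dist_triangle4 x (σ s) (σ t) y
  linarith

end metric

/-! ### Functions with small second differences are continuously differentiable -/

section secondDifference

variable {E : Type*} [NormedAddCommGroup E] [NormedSpace ℝ E] [CompleteSpace E]

/-- The difference quotients with steps `η / 2 ^ k` form a uniform Cauchy sequence: two consecutive
ones differ by a second difference divided by the step, which is geometric of ratio `√(1/2)`. Their
limit is continuous and `f` is a primitive of it. The quotients look ahead by up to `η`, hence the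
loss from `b` to `b'`. -/
theorem exists_contDiff_one_eqOn_of_second_difference_le_of_continuous {f : ℝ → E}
    (hf : Continuous f) {a b b' C : ℝ} (hab : a ≤ b') (hb : b' < b)
    (h : ∀ s k, a ≤ s → 0 < k → s + 2 * k ≤ b →
      ‖f s + f (s + 2 * k) - (2 : ℝ) • f (s + k)‖ ≤ C * (k * √k)) :
    ∃ F : ℝ → E, ContDiff ℝ 1 F ∧ EqOn f F (Icc a b') := by
  set η := b - b' with hη
  have hη0 : 0 < η := sub_pos.2 hb
  let ε : ℕ → ℝ := fun k ↦ η / 2 ^ k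
  have hε0 : ∀ k, 0 < ε k := fun k ↦ by positivity
  have hεη : ∀ k, ε k ≤ η := fun k ↦ div_le_self hη0.le (one_le_pow₀ one_le_two)
  let D : ℕ → ℝ → E := fun k s ↦ (ε k)⁻¹ • (f (s + ε k) - f s)
  have hDc : ∀ k, Continuous (D k) := fun k ↦ by fun_prop
  set r := √(1 / 2) with hr
  have hr1 : r < 1 := by
    rw [hr, Real.sqrt_lt' one_pos]; norm_num
  have hr0 : 0 ≤ r := Real.sqrt_nonneg _
  have hstep : ∀ s ∈ Icc a b', ∀ k, dist (D k s) (D (k + 1) s) ≤ C / 2 * √(η / 2) * r ^ k := by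
    intro s hs k
    have e1 : ε k = 2 * ε (k + 1) := by simp only [ε, pow_succ]; field_simp
    have e2 := h s (ε (k + 1)) hs.1 (hε0 _) (by
      rw [← e1]; have := hεη k; linarith [hs.2])
    have e3 : √(ε (k + 1)) = √(η / 2) * r ^ k := by
      have e5 : ε (k + 1) = η / 2 * (1 / 2) ^ k := by
        simp only [ε, pow_succ, one_div, inv_pow]; field_simp
      rw [hr, e5, Real.sqrt_mul (by positivity)]
      congr 1
      rw [Real.sqrt_eq_iff_mul_self_eq (by positivity) (by positivity), ← mul_pow,
        Real.mul_self_sqrt (by norm_num)]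
    have e4 : D k s - D (k + 1) s =
        (ε k)⁻¹ • (f s + f (s + 2 * ε (k + 1)) - (2 : ℝ) • f (s + ε (k + 1))) := by
      have : (ε (k + 1))⁻¹ = (ε k)⁻¹ * 2 := by
        rw [e1, mul_inv]; ring
      simp only [D, this, ← e1]
      module
    rw [dist_eq_norm, e4, norm_smul, norm_inv, Real.norm_of_nonneg (hε0 k).le]
    calc (ε k)⁻¹ * _ ≤ (ε k)⁻¹ * (C * (ε (k + 1) * √(ε (k + 1)))) :=
          mul_le_mul_of_nonneg_left e2 (inv_nonneg.2 (hε0 k).le)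
      _ = C / 2 * √(η / 2) * r ^ k := by
          rw [e3, e1]
          have := (hε0 (k + 1)).ne'
          field_simp
  have hlim : ∀ s, ∃ v, s ∈ Icc a b' → Tendsto (fun k ↦ D k s) atTop (𝓝 v) := by
    intro s
    by_cases hs : s ∈ Icc a b'
    · obtain ⟨v, hv⟩ := cauchySeq_tendsto_of_complete
        (cauchySeq_of_le_geometric r _ hr1 (hstep s hs))
      exact ⟨v, fun _ ↦ hv⟩
    · exact ⟨0, fun h ↦ absurd h hs⟩
  choose v hv using hlim
  have hbound : ∀ k, ∀ s ∈ Icc a b', dist (D k s) (v s) ≤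
      C / 2 * √(η / 2) * r ^ k / (1 - r) := fun k s hs ↦
    dist_le_of_le_geometric_of_tendsto r _ hr1 (hstep s hs) (hv s hs) k
  have hb0 : Tendsto (fun k ↦ C / 2 * √(η / 2) * r ^ k / (1 - r)) atTop (𝓝 0) := by
    have := ((tendsto_pow_atTop_nhds_zero_of_lt_one hr0 hr1).const_mul
      (C / 2 * √(η / 2))).div_const (1 - r)
    simpa using this
  have hunif : TendstoUniformlyOn D v atTop (Icc a b') := by
    rw [Metric.tendstoUniformlyOn_iff]
    intro δ hδ
    filter_upwards [hb0.eventually_lt_const hδ] with k hk s hs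
    rw [dist_comm]
    exact (hbound k s hs).trans_lt hk
  have hvc : ContinuousOn v (Icc a b') :=
    hunif.continuousOn (Frequently.of_forall fun k ↦ (hDc k).continuousOn)
  let w : ℝ → E := IccExtend hab ((Icc a b').domRestrict v)
  have hw : Continuous w := (continuousOn_iff_continuous_domRestrict.1 hvc).Icc_extend'
  have hwv : ∀ s ∈ Icc a b', w s = v s := fun s hs ↦ IccExtend_of_mem hab _ hs
  have hW : ∀ t, HasDerivAt (fun t ↦ f a + ∫ s in a..t, w s) (w t) t := fun t ↦
    (hw.integral_hasStrictDerivAt a t).hasDerivAt.const_add _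
  refine ⟨fun t ↦ f a + ∫ s in a..t, w s, ?_, fun t ht ↦ ?_⟩
  · rw [contDiff_one_iff_deriv]
    refine ⟨fun t ↦ (hW t).differentiableAt, ?_⟩
    rw [show deriv (fun t ↦ f a + ∫ s in a..t, w s) = w from funext fun t ↦ (hW t).deriv]
    exact hw
  · let Φ : ℝ → E := fun t ↦ ∫ s in a..t, f s
    have hΦ : ∀ t, HasDerivAt Φ (f t) t := fun t ↦ (hf.integral_hasStrictDerivAt a t).hasDerivAt
    have hεt : Tendsto ε atTop (𝓝[≠] 0) := by
      refine tendsto_nhdsWithin_iff.2 ⟨?_, Eventually.of_forall fun k ↦ (hε0 k).ne'⟩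
      have := (tendsto_pow_atTop_nhds_zero_of_lt_one (r := (1 / 2 : ℝ)) (by norm_num)
        (by norm_num)).const_mul η
      simp only [mul_zero] at this
      refine this.congr fun k ↦ ?_
      simp [ε, div_eq_mul_inv]
    have hsl : ∀ t, Tendsto (fun k ↦ (ε k)⁻¹ • (Φ (t + ε k) - Φ t)) atTop (𝓝 (f t)) := fun t ↦
      (hasDerivAt_iff_tendsto_slope_zero.1 (hΦ t)).comp hεt
    have hint : ∀ k, ∫ s in a..t, D k s =
        (ε k)⁻¹ • (Φ (t + ε k) - Φ t) - (ε k)⁻¹ • (Φ (a + ε k) - Φ a) := by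
      intro k
      have i : ∀ x y, IntervalIntegrable f MeasureTheory.volume x y :=
        fun x y ↦ hf.intervalIntegrable x y
      have i' : IntervalIntegrable (fun s ↦ f (s + ε k)) MeasureTheory.volume a t :=
        Continuous.intervalIntegrable (by fun_prop) _ _
      have e1 : ∫ s in a..t, D k s = (ε k)⁻¹ • ((∫ s in a + ε k..t + ε k, f s) -
          ∫ s in a..t, f s) := by
        simp only [D]
        rw [intervalIntegral.integral_smul, intervalIntegral.integral_sub i' (i _ _),
          intervalIntegral.integral_comp_add_right]
      have e2 : ∫ s in a + ε k..t + ε k, f s = Φ (t + ε k) - Φ (a + ε k) :=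
        (intervalIntegral.integral_interval_sub_left (i _ _) (i _ _)).symm
      have e3 : Φ a = 0 := intervalIntegral.integral_same
      rw [e1, e2, e3]
      simp only [Φ]
      module
    have h1 : Tendsto (fun k ↦ ∫ s in a..t, D k s) atTop (𝓝 (f t - f a)) := by
      simp only [hint]
      exact (hsl t).sub (hsl a)
    have h2 : Tendsto (fun k ↦ ∫ s in a..t, D k s) atTop (𝓝 (∫ s in a..t, w s)) := by
      rw [tendsto_iff_dist_tendsto_zero]
      have hz := hb0.mul_const (t - a)
      rw [zero_mul] at hz
      refine squeeze_zero (fun _ ↦ dist_nonneg) (fun k ↦ ?_) hz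
      rw [dist_eq_norm, ← intervalIntegral.integral_sub ((hDc k).intervalIntegrable _ _)
        (hw.intervalIntegrable _ _)]
      refine (intervalIntegral.norm_integral_le_of_norm_le_const fun s hs ↦ ?_).trans_eq
        (by rw [abs_of_nonneg (sub_nonneg.2 ht.1)])
      rw [uIoc_of_le ht.1] at hs
      have hs' : s ∈ Icc a b' := ⟨hs.1.le, hs.2.trans ht.2⟩
      rw [hwv s hs', ← dist_eq_norm]
      exact hbound k s hs'
    have := tendsto_nhds_unique h1 h2
    dsimp only
    rw [← this]
    abel

theorem exists_contDiff_one_eqOn_of_second_difference_le {f : ℝ → E} {a b b' C : ℝ}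
    (hf : ContinuousOn f (Icc a b)) (hab : a ≤ b') (hb : b' < b)
    (h : ∀ s k, a ≤ s → 0 < k → s + 2 * k ≤ b →
      ‖f s + f (s + 2 * k) - (2 : ℝ) • f (s + k)‖ ≤ C * (k * √k)) :
    ∃ F : ℝ → E, ContDiff ℝ 1 F ∧ EqOn f F (Icc a b') := by
  have hab' : a ≤ b := hab.trans hb.le
  have he : ∀ s ∈ Icc a b, IccExtend hab' ((Icc a b).domRestrict f) s = f s :=
    fun s hs ↦ IccExtend_of_mem hab' _ hs
  obtain ⟨F, hF, hFf⟩ := exists_contDiff_one_eqOn_of_second_difference_le_of_continuous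
    (f := IccExtend hab' ((Icc a b).domRestrict f))
    (continuousOn_iff_continuous_domRestrict.1 hf).Icc_extend' hab hb (C := C)
    (fun s k hs hk hsk ↦ by
      rw [he s ⟨hs, by linarith⟩, he (s + 2 * k) ⟨by linarith, hsk⟩,
        he (s + k) ⟨by linarith, by linarith⟩]
      exact h s k hs hk hsk)
  exact ⟨F, hF, fun s hs ↦ (he s ⟨hs.1, hs.2.trans hb.le⟩).symm.trans (hFf hs)⟩

theorem exists_contDiff_one_eqOn_of_second_difference_le_right {f : ℝ → E} {a b a' C : ℝ}
    (hf : ContinuousOn f (Icc a b)) (ha : a < a') (hab : a' ≤ b)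
    (h : ∀ s k, a ≤ s → 0 < k → s + 2 * k ≤ b →
      ‖f s + f (s + 2 * k) - (2 : ℝ) • f (s + k)‖ ≤ C * (k * √k)) :
    ∃ F : ℝ → E, ContDiff ℝ 1 F ∧ EqOn f F (Icc a' b) := by
  obtain ⟨F, hF, hFf⟩ := exists_contDiff_one_eqOn_of_second_difference_le
    (f := fun s ↦ f (-s)) (a := -b) (b := -a) (b' := -a') (C := C)
    (hf.comp continuousOn_neg fun s hs ↦ ⟨by linarith [hs.2], by linarith [hs.1]⟩)
    (by linarith) (by linarith) (fun s k hs hk hsk ↦ by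
      have := h (-(s + 2 * k)) k (by linarith) hk (by linarith)
      rw [show -(s + 2 * k) + 2 * k = -s by ring, show -(s + 2 * k) + k = -(s + k) by ring] at this
      rwa [add_comm (f (-s))])
  refine ⟨fun s ↦ F (-s), hF.comp contDiff_neg, fun s hs ↦ ?_⟩
  have := hFf (x := -s) ⟨by linarith [hs.2], by linarith [hs.1]⟩
  simpa using this

end secondDifference
-- Speeds and lengths of curves
section speed

variable {E : Type*} [NormedAddCommGroup E] [NormedSpace ℝ E]
  {H : Type*} [TopologicalSpace H] {I : ModelWithCorners ℝ E H}
  {S : Type*} [TopologicalSpace S] [ChartedSpace H S] [IsManifold I ∞ S]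

/-- The speed, with respect to the metric `g`, of a curve defined on `J`. -/
noncomputable def speed (g : SmoothRiemannianMetric I S) (γ : ℝ → S) (J : Set ℝ) (s : ℝ) : ℝ :=
  √(g.inner (γ s) (mfderivWithin 𝓘(ℝ, ℝ) I γ J s (1 : ℝ))
    (mfderivWithin 𝓘(ℝ, ℝ) I γ J s (1 : ℝ)))

theorem speed_nonneg (g : SmoothRiemannianMetric I S) (γ : ℝ → S) (J : Set ℝ) (s : ℝ) :
    0 ≤ speed g γ J s := Real.sqrt_nonneg _

theorem inner_self_nonneg (g : SmoothRiemannianMetric I S) (x : S) (v : TangentSpace I x) :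
    0 ≤ g.inner x v v := by
  rcases eq_or_ne v 0 with rfl | hv
  · simp
  · exact (g.pos x v hv).le

theorem isContinuousRiemannianBundle (g : SmoothRiemannianMetric I S) :
    letI : RiemannianBundle (fun x : S ↦ TangentSpace I x) := ⟨g.toRiemannianMetric⟩
    IsContinuousRiemannianBundle E (fun x : S ↦ TangentSpace I x) :=
  letI : RiemannianBundle (fun x : S ↦ TangentSpace I x) := ⟨g.toRiemannianMetric⟩
  ⟨g.inner, g.contMDiff.continuous, fun _ _ _ ↦ rfl⟩

theorem continuousOn_speed (g : SmoothRiemannianMetric I S) {γ : ℝ → S} {J : Set ℝ}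
    (hγ : ContMDiffOn 𝓘(ℝ, ℝ) I 1 γ J) (hJ : UniqueDiffOn ℝ J) :
    ContinuousOn (speed g γ J) J := by
  have h1 := hγ.continuousOn_tangentMapWithin le_rfl hJ.uniqueMDiffOn
  have h2 : ContinuousOn (fun s : ℝ ↦ (⟨s, (1 : ℝ)⟩ : TangentBundle 𝓘(ℝ, ℝ) ℝ)) J := by
    refine Continuous.continuousOn ?_
    have : ContMDiff 𝓘(ℝ, ℝ) (𝓘(ℝ, ℝ).prod 𝓘(ℝ, ℝ)) ∞
        (fun t : ℝ ↦ TotalSpace.mk' ℝ (E := fun t : ℝ ↦ TangentSpace 𝓘(ℝ, ℝ) t) t (1 : ℝ)) :=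
      contMDiff_vectorSpace_iff_contDiff.2 (contDiff_const (c := (1 : ℝ)))
    exact this.continuous
  have h3 := h1.comp h2 (fun s hs ↦ hs)
  let _ : RiemannianBundle (fun x : S ↦ TangentSpace I x) := ⟨g.toRiemannianMetric⟩
  have := isContinuousRiemannianBundle g
  exact (ContinuousOn.inner_bundle (F := E) (E := fun x : S ↦ TangentSpace I x) (b := γ) h3 h3).sqrt

theorem riemannianDist_le_of_speed_le (g : SmoothRiemannianMetric I S) {γ : ℝ → S} {a b : ℝ}
    (hab : a ≤ b) (hγ : ContMDiffOn 𝓘(ℝ, ℝ) I 1 γ (Icc a b)) {h : ℝ → ℝ}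
    (hc : ContinuousOn h (Icc a b)) (hh : ∀ s ∈ Icc a b, speed g γ (Icc a b) s ≤ h s) :
    riemannianDist g (γ a) (γ b) ≤ ENNReal.ofReal (∫ s in a..b, h s) := by
  let _ : RiemannianBundle (fun x : S ↦ TangentSpace I x) := ⟨g.toRiemannianMetric⟩
  refine (riemannianEDist_le_pathELength hγ rfl rfl hab).trans ?_
  rw [pathELength_eq_lintegral_mfderivWithin_Icc, intervalIntegral.integral_of_le hab,
    ← MeasureTheory.integral_Icc_eq_integral_Ioc,
    MeasureTheory.ofReal_integral_eq_lintegral_ofReal hc.integrableOn_Icc]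
  · refine MeasureTheory.setLIntegral_mono' measurableSet_Icc fun s hs ↦ ?_
    rw [← ofReal_norm]
    refine ENNReal.ofReal_le_ofReal (le_trans (le_of_eq ?_) (hh s hs))
    rw [norm_eq_sqrt_real_inner]
    rfl
  · filter_upwards [MeasureTheory.ae_restrict_mem measurableSet_Icc] with s hs
    exact (speed_nonneg g γ _ s).trans (hh s hs)

/-- The path is constant near both ends so that consecutive paths can be glued without losing `C^1`
regularity. -/
theorem exists_path_of_riemannianDist_lt (g : SmoothRiemannianMetric I S) {x y : S} {r a b : ℝ}
    (hab : a < b) (hr : riemannianDist g x y < ENNReal.ofReal r) :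
    ∃ γ : ℝ → S, ContMDiff 𝓘(ℝ, ℝ) I 1 γ ∧ γ a = x ∧ γ b = y ∧
      ∫ s in a..b, speed g γ univ s < r ∧ γ =ᶠ[𝓝 a] (fun _ ↦ x) ∧ γ =ᶠ[𝓝 b] (fun _ ↦ y) := by
  let _ : RiemannianBundle (fun x : S ↦ TangentSpace I x) := ⟨g.toRiemannianMetric⟩
  obtain ⟨γ, ha, hb, hγ, hl, hca, hcb⟩ :=
    exists_lt_locally_constant_of_riemannianEDist_lt (I := I)
      (show riemannianEDist I x y < _ from hr) hab
  refine ⟨γ, hγ, ha, hb, ?_, hca, hcb⟩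
  have hc : ContinuousOn (speed g γ univ) univ :=
    continuousOn_speed g hγ.contMDiffOn uniqueDiffOn_univ
  rw [pathELength_eq_lintegral_mfderiv_Icc] at hl
  have hr0 : 0 < r := ENNReal.ofReal_pos.1 (bot_le.trans_lt hr)
  rw [← ENNReal.ofReal_lt_ofReal_iff hr0]
  refine lt_of_eq_of_lt ?_ hl
  rw [intervalIntegral.integral_of_le hab.le,
    ← MeasureTheory.integral_Icc_eq_integral_Ioc,
    MeasureTheory.ofReal_integral_eq_lintegral_ofReal
      (hc.mono (subset_univ _)).integrableOn_Icc
      (Eventually.of_forall fun s ↦ speed_nonneg g γ _ s)]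
  refine MeasureTheory.lintegral_congr fun s ↦ ?_
  rw [← ofReal_norm, norm_eq_sqrt_real_inner, speed, mfderivWithin_univ]
  rfl

/-- The Riemannian distance as a real number. -/
noncomputable def rdist (g : SmoothRiemannianMetric I S) (x y : S) : ℝ :=
  (riemannianDist g x y).toReal

theorem rdist_nonneg (g : SmoothRiemannianMetric I S) (x y : S) : 0 ≤ rdist g x y :=
  ENNReal.toReal_nonneg

theorem rdist_le_of_speed_le (g : SmoothRiemannianMetric I S) {γ : ℝ → S} {a b : ℝ}
    (hab : a ≤ b) (hγ : ContMDiffOn 𝓘(ℝ, ℝ) I 1 γ (Icc a b)) {h : ℝ → ℝ}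
    (hc : ContinuousOn h (Icc a b)) (hh : ∀ s ∈ Icc a b, speed g γ (Icc a b) s ≤ h s) :
    rdist g (γ a) (γ b) ≤ ∫ s in a..b, h s :=
  ENNReal.toReal_le_of_le_ofReal
    (intervalIntegral.integral_nonneg hab fun s hs ↦ (speed_nonneg g γ _ s).trans (hh s hs))
    (riemannianDist_le_of_speed_le g hab hγ hc hh)

theorem speed_Icc_eq (g : SmoothRiemannianMetric I S) {γ : ℝ → S} {a b s : ℝ} (hab : a < b)
    {J : Set ℝ} (hJ : Icc a b ⊆ J) (hs : s ∈ Icc a b)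
    (hγ : MDifferentiableWithinAt 𝓘(ℝ, ℝ) I γ J s) :
    speed g γ (Icc a b) s = speed g γ J s := by
  rw [speed, speed, mfderivWithin_subset hJ
    ((uniqueDiffOn_Icc hab).uniqueMDiffOn s hs) hγ]

theorem continuous_speed (g : SmoothRiemannianMetric I S) {γ : ℝ → S}
    (hγ : ContMDiff 𝓘(ℝ, ℝ) I 1 γ) : Continuous (speed g γ univ) :=
  continuousOn_univ.1 (continuousOn_speed g hγ.contMDiffOn uniqueDiffOn_univ)

end speed

/-! ### The metric space of a connected Riemannian manifold -/

section distance

variable {E : Type*} [NormedAddCommGroup E] [NormedSpace ℝ E]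
  {H : Type*} [TopologicalSpace H] {I : ModelWithCorners ℝ E H}
  {S : Type*} [TopologicalSpace S] [ChartedSpace H S] [IsManifold I ∞ S]
  [T3Space S] [ConnectedSpace S]

/-- The extended metric space structure given by a Riemannian metric. -/
@[reducible] noncomputable def emetricSpaceOf (g : SmoothRiemannianMetric I S) : EMetricSpace S :=
  letI : RiemannianBundle (fun x : S ↦ TangentSpace I x) := ⟨g.toRiemannianMetric⟩
  haveI := isContinuousRiemannianBundle g
  EMetricSpace.ofRiemannianMetric I S

theorem riemannianDist_ne_top (g : SmoothRiemannianMetric I S) (x y : S) :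
    riemannianDist g x y ≠ ⊤ := by
  let _ : EMetricSpace S := emetricSpaceOf g
  -- The points at finite distance from `x` form a clopen set, so connectedness makes all distances
  -- finite.
  have h : IsClopen (Metric.eball x ⊤) := ⟨Metric.isClosed_eball_top, Metric.isOpen_eball⟩
  have h' := h.eq_univ ⟨x, Metric.mem_eball_self (by simp)⟩
  have : y ∈ Metric.eball x ⊤ := h' ▸ mem_univ y
  rw [Metric.mem_eball'] at this
  exact ne_of_lt this

/-- The metric space structure given by a Riemannian metric on a connected manifold. -/
@[reducible] noncomputable def metricSpaceOf (g : SmoothRiemannianMetric I S) : MetricSpace S :=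
  letI : EMetricSpace S := emetricSpaceOf g
  EMetricSpace.toMetricSpace (riemannianDist_ne_top g)

theorem ofReal_rdist (g : SmoothRiemannianMetric I S) (x y : S) :
    ENNReal.ofReal (rdist g x y) = riemannianDist g x y :=
  ENNReal.ofReal_toReal (riemannianDist_ne_top g x y)

theorem riemannianDist_lt_ofReal (g : SmoothRiemannianMetric I S) {x y : S} {r : ℝ} :
    riemannianDist g x y < ENNReal.ofReal r ↔ rdist g x y < r := by
  rw [← ofReal_rdist, ENNReal.ofReal_lt_ofReal_iff_of_nonneg (rdist_nonneg g x y)]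

theorem rdist_self (g : SmoothRiemannianMetric I S) (x : S) : rdist g x x = 0 :=
  @dist_self S (metricSpaceOf g).toPseudoMetricSpace x

theorem rdist_comm (g : SmoothRiemannianMetric I S) (x y : S) : rdist g x y = rdist g y x :=
  @dist_comm S (metricSpaceOf g).toPseudoMetricSpace x y

theorem rdist_triangle (g : SmoothRiemannianMetric I S) (x y z : S) :
    rdist g x z ≤ rdist g x y + rdist g y z :=
  @dist_triangle S (metricSpaceOf g).toPseudoMetricSpace x y z

theorem eq_of_rdist_le_zero (g : SmoothRiemannianMetric I S) {x y : S} (h : rdist g x y ≤ 0) :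
    x = y :=
  @dist_le_zero S (metricSpaceOf g) x y |>.1 h

theorem continuous_rdist (g : SmoothRiemannianMetric I S) :
    Continuous fun p : S × S ↦ rdist g p.1 p.2 :=
  @continuous_dist S (metricSpaceOf g).toPseudoMetricSpace

theorem rdist_le_integral_speed (g : SmoothRiemannianMetric I S) {γ : ℝ → S} {a b : ℝ}
    (hab : a ≤ b) (hγ : ContMDiff 𝓘(ℝ, ℝ) I 1 γ) :
    rdist g (γ a) (γ b) ≤ ∫ s in a..b, speed g γ univ s := by
  rcases hab.eq_or_lt with rfl | hab
  · simp [rdist_self]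
  · exact rdist_le_of_speed_le g hab.le hγ.contMDiffOn
      ((continuousOn_speed g hγ.contMDiffOn uniqueDiffOn_univ).mono (subset_univ _))
      fun s hs ↦ (speed_Icc_eq g hab (subset_univ _) hs
        ((hγ.mdifferentiable one_ne_zero s).mdifferentiableWithinAt)).le

theorem exists_path_of_rdist_lt (g : SmoothRiemannianMetric I S) {x y : S} {r a b : ℝ}
    (hab : a < b) (hr : rdist g x y < r) :
    ∃ γ : ℝ → S, ContMDiff 𝓘(ℝ, ℝ) I 1 γ ∧ γ a = x ∧ γ b = y ∧
      ∫ s in a..b, speed g γ univ s < r ∧ γ =ᶠ[𝓝 a] (fun _ ↦ x) ∧ γ =ᶠ[𝓝 b] (fun _ ↦ y) :=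
  exists_path_of_riemannianDist_lt g hab ((riemannianDist_lt_ofReal g).2 hr)

theorem hasShortPaths (g : SmoothRiemannianMetric I S) :
    @HasShortPaths S (metricSpaceOf g) := by
  intro x y ε hε
  obtain ⟨γ, hγ, h0, h1, hl, -⟩ :=
    exists_path_of_rdist_lt g zero_lt_one (lt_add_of_pos_right (rdist g x y) hε)
  refine ⟨γ, hγ.continuous.continuousOn, h0, h1, fun s t hs hst ht ↦ ?_⟩
  have i : ∀ a b, IntervalIntegrable (speed g γ univ) MeasureTheory.volume a b :=
    fun a b ↦ (continuous_speed g hγ).intervalIntegrable a b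
  have e1 := rdist_le_integral_speed g hs hγ
  have e2 := rdist_le_integral_speed g hst hγ
  have e3 := rdist_le_integral_speed g ht hγ
  rw [h0] at e1
  rw [h1] at e3
  have e4 := intervalIntegral.integral_add_adjacent_intervals (i 0 s) (i s t)
  have e5 := intervalIntegral.integral_add_adjacent_intervals (i 0 t) (i t 1)
  change rdist g x (γ s) + rdist g (γ s) (γ t) + rdist g (γ t) y ≤ rdist g x y + ε
  linarith

theorem completeSpace_of_isCompleteMetric {g : SmoothRiemannianMetric I S}
    (hg : IsCompleteMetric g) : @CompleteSpace S (metricSpaceOf g).toUniformSpace := by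
  let _ := metricSpaceOf g
  refine Metric.complete_of_cauchySeq_tendsto fun u hu ↦ hg u fun ε hε ↦ ?_
  exact EMetric.cauchySeq_iff.1 hu ε hε

theorem cauchySeq_of_riemannianDist {g : SmoothRiemannianMetric I S} {u : ℕ → S}
    (hu : ∀ ε : ℝ≥0∞, 0 < ε → ∃ N, ∀ m ≥ N, ∀ n ≥ N, riemannianDist g (u m) (u n) < ε) :
    @CauchySeq S ℕ (metricSpaceOf g).toUniformSpace _ u := by
  let _ := metricSpaceOf g
  exact EMetric.cauchySeq_iff.2 hu

end distance
-- The metric read in a chart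
section chart

variable {E : Type*} [NormedAddCommGroup E] [NormedSpace ℝ E]
  {S : Type*} [TopologicalSpace S] [ChartedSpace E S] [IsManifold 𝓘(ℝ, E) ∞ S]

/-- The Riemannian metric `g` read in the chart at `x₀`, as a field of bilinear forms on `E`. -/
noncomputable def chartForm (g : SmoothRiemannianMetric 𝓘(ℝ, E) S) (x₀ : S) (p : E) :
    E →L[ℝ] E →L[ℝ] ℝ :=
  inCoordinates E (TangentSpace 𝓘(ℝ, E)) (E →L[ℝ] ℝ) (fun y : S ↦ TangentSpace 𝓘(ℝ, E) y →L[ℝ] ℝ)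
    x₀ ((extChartAt 𝓘(ℝ, E) x₀).symm p) x₀ ((extChartAt 𝓘(ℝ, E) x₀).symm p)
    (g.inner ((extChartAt 𝓘(ℝ, E) x₀).symm p))

theorem chartForm_apply (g : SmoothRiemannianMetric 𝓘(ℝ, E) S) {x₀ y : S}
    (hy : y ∈ (extChartAt 𝓘(ℝ, E) x₀).source) (v w : E) :
    chartForm g x₀ (extChartAt 𝓘(ℝ, E) x₀ y) v w =
      g.inner y ((trivializationAt E (TangentSpace 𝓘(ℝ, E)) x₀).symm y v)
        ((trivializationAt E (TangentSpace 𝓘(ℝ, E)) x₀).symm y w) := by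
  have hy' : y ∈ (trivializationAt E (TangentSpace 𝓘(ℝ, E) : S → Type _) x₀).baseSet := by
    simpa using hy
  rw [chartForm, (extChartAt 𝓘(ℝ, E) x₀).left_inv hy,
    inCoordinates_apply_eq₂ hy' hy' (Set.mem_univ _)]
  simp

/-- The derivative at `y` of the chart at `x₀`. -/
noncomputable def chartDeriv (x₀ y : S) : TangentSpace 𝓘(ℝ, E) y →L[ℝ] E :=
  (trivializationAt E (TangentSpace 𝓘(ℝ, E)) x₀).continuousLinearMapAt ℝ y

theorem chartForm_chartDeriv (g : SmoothRiemannianMetric 𝓘(ℝ, E) S) {x₀ y : S}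
    (hy : y ∈ (extChartAt 𝓘(ℝ, E) x₀).source) (u w : TangentSpace 𝓘(ℝ, E) y) :
    chartForm g x₀ (extChartAt 𝓘(ℝ, E) x₀ y) (chartDeriv x₀ y u) (chartDeriv x₀ y w) =
      g.inner y u w := by
  have hy' : y ∈ (trivializationAt E (TangentSpace 𝓘(ℝ, E) : S → Type _) x₀).baseSet := by
    simpa using hy
  have key : ∀ u : TangentSpace 𝓘(ℝ, E) y,
      (trivializationAt E (TangentSpace 𝓘(ℝ, E)) x₀).symm y (chartDeriv x₀ y u) = u := by
    intro u
    have := (trivializationAt E (TangentSpace 𝓘(ℝ, E)) x₀).symmL_continuousLinearMapAt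
      (R := ℝ) hy' u
    rw [Trivialization.symmL_apply] at this
    · exact this
    · exact hy'
  rw [chartForm_apply g hy, key, key]

theorem hasDerivWithinAt_extChartAt_comp {x₀ : S} {γ : ℝ → S} {J : Set ℝ} {s : ℝ}
    (hγ : MDifferentiableWithinAt 𝓘(ℝ, ℝ) 𝓘(ℝ, E) γ J s)
    (hs : γ s ∈ (extChartAt 𝓘(ℝ, E) x₀).source) :
    HasDerivWithinAt (extChartAt 𝓘(ℝ, E) x₀ ∘ γ)
      (chartDeriv x₀ (γ s) (mfderivWithin 𝓘(ℝ, ℝ) 𝓘(ℝ, E) γ J s (1 : ℝ))) J s := by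
  have hs' : γ s ∈ (chartAt E x₀).source := by simpa using hs
  have h := (mdifferentiableAt_extChartAt hs').hasMFDerivAt.comp_hasMFDerivWithinAt s
    hγ.hasMFDerivWithinAt
  rw [← TangentBundle.continuousLinearMapAt_trivializationAt hs'] at h
  let A : ℝ →L[ℝ] E :=
    (chartDeriv x₀ (γ s)).comp (mfderivWithin 𝓘(ℝ, ℝ) 𝓘(ℝ, E) γ J s)
  have h' : HasFDerivWithinAt (extChartAt 𝓘(ℝ, E) x₀ ∘ γ) A J s :=
    hasMFDerivWithinAt_iff_hasFDerivWithinAt.1 h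
  exact h'.hasDerivWithinAt

theorem contDiffAt_chartForm (g : SmoothRiemannianMetric 𝓘(ℝ, E) S) (x₀ : S) :
    ContDiffAt ℝ 1 (chartForm g x₀) (extChartAt 𝓘(ℝ, E) x₀ x₀) := by
  have h1 := ((contMDiffAt_hom_bundle _).1 (g.contMDiff x₀)).2
  have h2 : ContMDiffAt 𝓘(ℝ, E) 𝓘(ℝ, E) ∞ (extChartAt 𝓘(ℝ, E) x₀).symm
      (extChartAt 𝓘(ℝ, E) x₀ x₀) :=
    (contMDiffOn_extChartAt_symm x₀).contMDiffAt (extChartAt_target_mem_nhds x₀)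
  have h3 := ContMDiffAt.comp_of_eq h1 h2 (extChartAt_to_inv x₀)
  exact (contMDiffAt_iff_contDiffAt.1 h3).of_le (by simp)

theorem chartForm_symm (g : SmoothRiemannianMetric 𝓘(ℝ, E) S) {x₀ : S} {p : E}
    (hp : p ∈ (extChartAt 𝓘(ℝ, E) x₀).target) (v w : E) :
    chartForm g x₀ p v w = chartForm g x₀ p w v := by
  have h := chartForm_apply g ((extChartAt 𝓘(ℝ, E) x₀).map_target hp)
  rw [(extChartAt 𝓘(ℝ, E) x₀).right_inv hp] at h
  rw [h, h, g.symm]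

theorem chartForm_self_nonneg (g : SmoothRiemannianMetric 𝓘(ℝ, E) S) {x₀ : S} {p : E}
    (hp : p ∈ (extChartAt 𝓘(ℝ, E) x₀).target) (v : E) : 0 ≤ chartForm g x₀ p v v := by
  have h := chartForm_apply g ((extChartAt 𝓘(ℝ, E) x₀).map_target hp)
  rw [(extChartAt 𝓘(ℝ, E) x₀).right_inv hp] at h
  rw [h]
  exact inner_self_nonneg g _ _

theorem chartForm_self_pos (g : SmoothRiemannianMetric 𝓘(ℝ, E) S) (x₀ : S) {v : E} (hv : v ≠ 0) :
    0 < chartForm g x₀ (extChartAt 𝓘(ℝ, E) x₀ x₀) v v := by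
  rw [chartForm_apply g (mem_extChartAt_source x₀)]
  refine g.pos _ _ fun h ↦ hv ?_
  have hy' : x₀ ∈ (trivializationAt E (TangentSpace 𝓘(ℝ, E) : S → Type _) x₀).baseSet :=
    FiberBundle.mem_baseSet_trivializationAt' x₀
  have := (trivializationAt E (TangentSpace 𝓘(ℝ, E)) x₀).continuousLinearMapAt_symmL (R := ℝ) hy' v
  rw [Trivialization.symmL_apply] at this
  · rw [← this]
    exact (congrArg _ h).trans (map_zero _)
  · exact hy'

/-- The norm on `E` given by the Riemannian metric read in a chart. -/
noncomputable def chartNorm (g : SmoothRiemannianMetric 𝓘(ℝ, E) S) (x₀ : S) (p v : E) : ℝ :=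
  √(chartForm g x₀ p v v)

theorem chartNorm_nonneg (g : SmoothRiemannianMetric 𝓘(ℝ, E) S) (x₀ : S) (p v : E) :
    0 ≤ chartNorm g x₀ p v := Real.sqrt_nonneg _

theorem chartNorm_smul (g : SmoothRiemannianMetric 𝓘(ℝ, E) S) (x₀ : S) (p v : E) (c : ℝ) :
    chartNorm g x₀ p (c • v) = |c| * chartNorm g x₀ p v := by
  rw [chartNorm, chartNorm, ← Real.sqrt_sq_eq_abs, ← Real.sqrt_mul (sq_nonneg c)]
  congr 1
  simp only [map_smul, smul_apply, smul_eq_mul]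
  ring

theorem chartNorm_sq (g : SmoothRiemannianMetric 𝓘(ℝ, E) S) {x₀ : S} {p : E}
    (hp : p ∈ (extChartAt 𝓘(ℝ, E) x₀).target) (v : E) :
    chartNorm g x₀ p v ^ 2 = chartForm g x₀ p v v :=
  Real.sq_sqrt (chartForm_self_nonneg g hp v)

theorem chartForm_le_chartNorm_mul (g : SmoothRiemannianMetric 𝓘(ℝ, E) S) {x₀ : S} {p : E}
    (hp : p ∈ (extChartAt 𝓘(ℝ, E) x₀).target) (v w : E) :
    chartForm g x₀ p v w ≤ chartNorm g x₀ p v * chartNorm g x₀ p w := by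
  let B : LinearMap.BilinForm ℝ E :=
    LinearMap.mk₂ ℝ (fun v w ↦ chartForm g x₀ p v w) (by simp) (by simp) (by simp) (by simp)
  have h := B.apply_mul_apply_le_of_forall_zero_le (chartForm_self_nonneg g hp) v w
  change chartForm g x₀ p v w * chartForm g x₀ p w v ≤
    chartForm g x₀ p v v * chartForm g x₀ p w w at h
  rw [chartForm_symm g hp w v, ← chartNorm_sq g hp, ← chartNorm_sq g hp, ← mul_pow,
    ← sq] at h
  exact le_of_sq_le_sq h
    (mul_nonneg (chartNorm_nonneg _ _ _ _) (chartNorm_nonneg _ _ _ _))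

theorem speed_eq_chartNorm (g : SmoothRiemannianMetric 𝓘(ℝ, E) S) {x₀ : S} {γ : ℝ → S} {J : Set ℝ}
    {s : ℝ} (hs : γ s ∈ (extChartAt 𝓘(ℝ, E) x₀).source) :
    speed g γ J s = chartNorm g x₀ (extChartAt 𝓘(ℝ, E) x₀ (γ s))
      (chartDeriv x₀ (γ s) (mfderivWithin 𝓘(ℝ, ℝ) 𝓘(ℝ, E) γ J s (1 : ℝ))) := by
  rw [speed, chartNorm, chartForm_chartDeriv g hs]

-- In the chart the form is `C^1`, hence Lipschitz near the centre, and on the unit sphere at the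
-- centre it has a positive minimum by compactness. Both facts pass from the form to its square root
-- because the norm is bounded below.
set_option synthInstance.maxHeartbeats 200000 in
theorem exists_chartNorm_bounds [FiniteDimensional ℝ E] (g : SmoothRiemannianMetric 𝓘(ℝ, E) S)
    (x₀ : S) :
    ∃ ρ > 0, ∃ m > 0, ∃ C ≥ 0,
      Metric.ball (extChartAt 𝓘(ℝ, E) x₀ x₀) ρ ⊆ (extChartAt 𝓘(ℝ, E) x₀).target ∧
      (∀ p ∈ Metric.ball (extChartAt 𝓘(ℝ, E) x₀ x₀) ρ, ∀ v, m * ‖v‖ ≤ chartNorm g x₀ p v) ∧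
      ∀ p ∈ Metric.ball (extChartAt 𝓘(ℝ, E) x₀ x₀) ρ,
        ∀ q ∈ Metric.ball (extChartAt 𝓘(ℝ, E) x₀ x₀) ρ, ∀ v,
          chartNorm g x₀ p v ≤ chartNorm g x₀ q v + C * ‖p - q‖ * ‖v‖ := by
  set p₀ := extChartAt 𝓘(ℝ, E) x₀ x₀ with hp₀
  obtain ⟨K, t, ht, hK⟩ := (contDiffAt_chartForm g x₀).exists_lipschitzOnWith
  obtain ⟨μ, hμ, hμv⟩ : ∃ μ > 0, ∀ v, μ * ‖v‖ ^ 2 ≤ chartForm g x₀ p₀ v v := by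
    have hc : ContinuousOn (fun v ↦ chartForm g x₀ p₀ v v) (Metric.sphere 0 1) := by fun_prop
    rcases (Metric.sphere (0 : E) 1).eq_empty_or_nonempty with he | hne
    · refine ⟨1, one_pos, fun v ↦ ?_⟩
      have hv : v = 0 := by
        by_contra hv
        have : ‖v‖⁻¹ • v ∈ Metric.sphere (0 : E) 1 := by
          simp [norm_smul, norm_ne_zero_iff.2 hv]
        simp [he] at this
      simp [hv]
    · obtain ⟨w, hw, hmin⟩ := (isCompact_sphere (0 : E) 1).exists_isMinOn hne hc
      have hw0 : w ≠ 0 := by rintro rfl; simp at hw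
      refine ⟨_, chartForm_self_pos g x₀ hw0, fun v ↦ ?_⟩
      rcases eq_or_ne v 0 with rfl | hv
      · simp
      have hv' : ‖v‖ ≠ 0 := norm_ne_zero_iff.2 hv
      have h1 : ‖v‖⁻¹ • v ∈ Metric.sphere (0 : E) 1 := by simp [norm_smul, hv']
      have h2 : chartForm g x₀ p₀ w w ≤ chartForm g x₀ p₀ (‖v‖⁻¹ • v) (‖v‖⁻¹ • v) := hmin h1
      simp only [map_smul, smul_apply, smul_eq_mul] at h2
      calc _ ≤ (‖v‖⁻¹ * (‖v‖⁻¹ * chartForm g x₀ p₀ v v)) * ‖v‖ ^ 2 :=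
            mul_le_mul_of_nonneg_right h2 (sq_nonneg _)
        _ = _ := by field_simp
  have hKn : ∀ p ∈ t, ∀ q ∈ t, ∀ v,
      chartForm g x₀ p v v ≤ chartForm g x₀ q v v + K * ‖p - q‖ * ‖v‖ ^ 2 := by
    intro p hp q hq v
    have h1 := hK.norm_sub_le hp hq
    have h2 := (chartForm g x₀ p - chartForm g x₀ q).le_opNorm₂ v v
    have h3 : chartForm g x₀ p v v - chartForm g x₀ q v v ≤
      ‖(chartForm g x₀ p - chartForm g x₀ q) v v‖ := by
      rw [Real.norm_eq_abs]; exact le_abs_self _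
    have h4 := mul_le_mul_of_nonneg_right h1 (sq_nonneg ‖v‖)
    nlinarith
  obtain ⟨ρ₁, hρ₁, hρ₁t⟩ := Metric.mem_nhds_iff.1 (inter_mem ht (extChartAt_target_mem_nhds x₀))
  -- On this radius the form varies by at most `μ / 2 * ‖v‖ ^ 2`, so at least half of the lower
  -- bound `μ` survives; `K + 1` avoids dividing by zero.
  have hρ : 0 < min ρ₁ (μ / (2 * (K + 1))) := by positivity
  set m := √(μ / 2) with hm
  have hm0 : 0 < m := by positivity
  have hlow : ∀ p ∈ Metric.ball p₀ (min ρ₁ (μ / (2 * (K + 1)))), ∀ v,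
      m * ‖v‖ ≤ chartNorm g x₀ p v := by
    intro p hp v
    have hp1 := hρ₁t (Metric.ball_subset_ball (min_le_left _ _) hp)
    have hp2 : ‖p₀ - p‖ ≤ μ / (2 * (K + 1)) := by
      rw [← dist_eq_norm, dist_comm]; exact (hp.trans_le (min_le_right _ _)).le
    have h1 := hKn p₀ (mem_of_mem_nhds ht) p hp1.1 v
    have h2 := hμv v
    have h3 : K * ‖p₀ - p‖ ≤ μ / 2 := by
      have : (K : ℝ) * ‖p₀ - p‖ ≤ (K + 1) * (μ / (2 * (K + 1))) := by gcongr; linarith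
      refine this.trans_eq ?_
      have : (K : ℝ) + 1 ≠ 0 := by positivity
      field_simp
    refine Real.le_sqrt_of_sq_le ?_
    rw [mul_pow, hm, Real.sq_sqrt (by positivity)]
    have := mul_le_mul_of_nonneg_right h3 (sq_nonneg ‖v‖)
    linarith
  refine ⟨_, hρ, m, hm0, K / m, by positivity, fun p hp ↦
    (hρ₁t (Metric.ball_subset_ball (min_le_left _ _) hp)).2, hlow, fun p hp q hq v ↦ ?_⟩
  have hp1 := hρ₁t (Metric.ball_subset_ball (min_le_left _ _) hp)
  have hq1 := hρ₁t (Metric.ball_subset_ball (min_le_left _ _) hq)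
  have hN := chartNorm_nonneg g x₀ q v
  refine Real.sqrt_le_iff.2 ⟨by positivity, (hKn p hp1.1 q hq1.1 v).trans ?_⟩
  rw [← chartNorm_sq g hq1.2]
  have h1 : K * ‖p - q‖ * ‖v‖ ^ 2 ≤ K / m * ‖p - q‖ * ‖v‖ * chartNorm g x₀ q v := by
    calc K * ‖p - q‖ * ‖v‖ ^ 2 = K / m * ‖p - q‖ * ‖v‖ * (m * ‖v‖) := by field_simp
      _ ≤ _ := by gcongr; exact hlow q hq v
  have h2 : 0 ≤ K / m * ‖p - q‖ * ‖v‖ * chartNorm g x₀ q v := by positivity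
  have h3 := sq_nonneg (K / m * ‖p - q‖ * ‖v‖)
  linarith [add_sq (chartNorm g x₀ q v) (K / m * ‖p - q‖ * ‖v‖)]

end chart
-- Comparison of the Riemannian distance with chart norms
section chartDistance

variable {E : Type*} [NormedAddCommGroup E] [NormedSpace ℝ E]
  {S : Type*} [TopologicalSpace S] [ChartedSpace E S] [IsManifold 𝓘(ℝ, E) ∞ S]

/-- On the ball of radius `ρ` in the chart at `x₀`, the norm given by the metric is at least `m`
times the norm of `E` and is `C`-Lipschitz with respect to the base point; this ball contains the
image of the ball of radius `4 * r` for the Riemannian distance. -/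
structure ChartBounds (g : SmoothRiemannianMetric 𝓘(ℝ, E) S) (x₀ : S) (ρ m C r : ℝ) : Prop where
  m_pos : 0 < m
  C_nonneg : 0 ≤ C
  r_pos : 0 < r
  ball_subset : Metric.ball (extChartAt 𝓘(ℝ, E) x₀ x₀) ρ ⊆ (extChartAt 𝓘(ℝ, E) x₀).target
  le_norm : ∀ p ∈ Metric.ball (extChartAt 𝓘(ℝ, E) x₀ x₀) ρ, ∀ v, m * ‖v‖ ≤ chartNorm g x₀ p v
  norm_le : ∀ p ∈ Metric.ball (extChartAt 𝓘(ℝ, E) x₀ x₀) ρ,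
    ∀ q ∈ Metric.ball (extChartAt 𝓘(ℝ, E) x₀ x₀) ρ, ∀ v,
      chartNorm g x₀ p v ≤ chartNorm g x₀ q v + C * ‖p - q‖ * ‖v‖
  mem_source : ∀ y, rdist g x₀ y < 4 * r → y ∈ (extChartAt 𝓘(ℝ, E) x₀).source
  mem_ball : ∀ y, rdist g x₀ y < 4 * r →
    extChartAt 𝓘(ℝ, E) x₀ y ∈ Metric.ball (extChartAt 𝓘(ℝ, E) x₀ x₀) ρ

variable {g : SmoothRiemannianMetric 𝓘(ℝ, E) S} {x₀ : S} {ρ m C r : ℝ}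

/-- The straight segment of the chart joins `y` to `z` and stays within `δ` of `w`, where the norm
differs from that at `w` by at most `C * δ` times the norm of `E`. -/
theorem ChartBounds.rdist_le (h : ChartBounds g x₀ ρ m C r) {y z w : S}
    (hy : rdist g x₀ y < r) (hz : rdist g x₀ z < r) (hw : rdist g x₀ w < r) {δ : ℝ}
    (hyδ : ‖extChartAt 𝓘(ℝ, E) x₀ y - extChartAt 𝓘(ℝ, E) x₀ w‖ ≤ δ)
    (hzδ : ‖extChartAt 𝓘(ℝ, E) x₀ z - extChartAt 𝓘(ℝ, E) x₀ w‖ ≤ δ) :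
    rdist g y z ≤ chartNorm g x₀ (extChartAt 𝓘(ℝ, E) x₀ w)
        (extChartAt 𝓘(ℝ, E) x₀ z - extChartAt 𝓘(ℝ, E) x₀ y) +
      C * δ * ‖extChartAt 𝓘(ℝ, E) x₀ z - extChartAt 𝓘(ℝ, E) x₀ y‖ := by
  have hr := h.r_pos
  have hC := h.C_nonneg
  set φ := extChartAt 𝓘(ℝ, E) x₀ with hφ
  have hyb : φ y ∈ Metric.ball (φ x₀) ρ := h.mem_ball y (by linarith)
  have hzb : φ z ∈ Metric.ball (φ x₀) ρ := h.mem_ball z (by linarith)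
  have hwb : φ w ∈ Metric.ball (φ x₀) ρ := h.mem_ball w (by linarith)
  have hys : y ∈ φ.source := h.mem_source y (by linarith)
  have hzs : z ∈ φ.source := h.mem_source z (by linarith)
  let η : ℝ → E := fun s ↦ φ y + s • (φ z - φ y)
  have hηd : ∀ s, HasDerivAt η (φ z - φ y) s := fun s ↦ by
    have := ((hasDerivAt_id s).smul_const (φ z - φ y)).const_add (φ y)
    rwa [one_smul] at this
  have hηc : ContDiff ℝ 1 η := by fun_prop
  have hηs : ∀ s ∈ Icc (0 : ℝ) 1, η s ∈ segment ℝ (φ y) (φ z) := fun s hs ↦ by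
    rw [segment_eq_image']
    exact ⟨s, hs, rfl⟩
  have hηb : ∀ s ∈ Icc (0 : ℝ) 1, η s ∈ Metric.ball (φ x₀) ρ := fun s hs ↦
    (convex_ball _ _).segment_subset hyb hzb (hηs s hs)
  have hηδ : ∀ s ∈ Icc (0 : ℝ) 1, ‖η s - φ w‖ ≤ δ := fun s hs ↦ by
    have := (convex_closedBall (φ w) δ).segment_subset (mem_closedBall_iff_norm.2 hyδ)
      (mem_closedBall_iff_norm.2 hzδ) (hηs s hs)
    exact mem_closedBall_iff_norm.1 this
  have hγ : ContMDiffOn 𝓘(ℝ, ℝ) 𝓘(ℝ, E) 1 (φ.symm ∘ η) (Icc 0 1) :=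
    (contMDiffOn_extChartAt_symm x₀).comp hηc.contMDiff.contMDiffOn
      fun s hs ↦ h.ball_subset (hηb s hs)
  have hφη : ∀ s ∈ Icc (0 : ℝ) 1, φ (φ.symm (η s)) = η s := fun s hs ↦
    φ.right_inv (h.ball_subset (hηb s hs))
  have hsp : ∀ s ∈ Icc (0 : ℝ) 1, speed g (φ.symm ∘ η) (Icc 0 1) s ≤
      chartNorm g x₀ (φ w) (φ z - φ y) + C * δ * ‖φ z - φ y‖ := by
    intro s hs
    have hsrc : (φ.symm ∘ η) s ∈ φ.source := φ.map_target (h.ball_subset (hηb s hs))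
    have hd := hasDerivWithinAt_extChartAt_comp (hγ.mdifferentiableOn one_ne_zero s hs) hsrc
    have hd' : HasDerivWithinAt (φ ∘ (φ.symm ∘ η)) (φ z - φ y) (Icc 0 1) s :=
      (hηd s).hasDerivWithinAt.congr (fun s hs ↦ hφη s hs) (hφη s hs)
    have he := (uniqueDiffOn_Icc zero_lt_one s hs).eq_deriv _ hd hd'
    rw [speed_eq_chartNorm g hsrc, he]
    refine (h.norm_le _ (mem_of_eq_of_mem (hφη s hs) (hηb s hs)) _ hwb _).trans ?_
    have := hηδ s hs
    rw [← hφη s hs] at this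
    gcongr
  have := rdist_le_of_speed_le g zero_le_one hγ continuousOn_const hsp
  simpa [η, φ.left_inv hys, φ.left_inv hzs] using this

variable [T3Space S] [ConnectedSpace S]

theorem exists_chartBounds [FiniteDimensional ℝ E] (g : SmoothRiemannianMetric 𝓘(ℝ, E) S)
    (x₀ : S) : ∃ ρ m C r, ChartBounds g x₀ ρ m C r := by
  obtain ⟨ρ, hρ, m, hm, C, hC, h1, h2, h3⟩ := exists_chartNorm_bounds g x₀
  have hn : (extChartAt 𝓘(ℝ, E) x₀).source ∩ extChartAt 𝓘(ℝ, E) x₀ ⁻¹'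
      Metric.ball (extChartAt 𝓘(ℝ, E) x₀ x₀) ρ ∈ 𝓝 x₀ :=
    inter_mem (extChartAt_source_mem_nhds x₀)
      ((continuousAt_extChartAt x₀).preimage_mem_nhds (Metric.ball_mem_nhds _ hρ))
  obtain ⟨r, hr, hrs⟩ := (@Metric.mem_nhds_iff S (metricSpaceOf g).toPseudoMetricSpace _ _).1 hn
  have key : ∀ y, rdist g x₀ y < 4 * (r / 4) → y ∈ (extChartAt 𝓘(ℝ, E) x₀).source ∩
      extChartAt 𝓘(ℝ, E) x₀ ⁻¹' Metric.ball (extChartAt 𝓘(ℝ, E) x₀ x₀) ρ := fun y hy ↦ by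
    refine hrs ?_
    change rdist g y x₀ < r
    rw [rdist_comm]
    linarith
  exact ⟨ρ, m, C, r / 4, hm, hC, by positivity, h1, h2, h3, fun y hy ↦ (key y hy).1,
    fun y hy ↦ (key y hy).2⟩

/-- A curve of length `ℓ` moves at most `ℓ / m` in the chart, so freezing the norm at `y` changes
its length by a factor of at most `1 + C / m ^ 2 * ℓ`; for a frozen norm no curve is shorter than
the segment. Then `ℓ` decreases to the distance. -/
theorem ChartBounds.chartNorm_sub_le (h : ChartBounds g x₀ ρ m C r) {y z : S}
    (hy : rdist g x₀ y < r) (hz : rdist g x₀ z < r) :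
    chartNorm g x₀ (extChartAt 𝓘(ℝ, E) x₀ y)
      (extChartAt 𝓘(ℝ, E) x₀ z - extChartAt 𝓘(ℝ, E) x₀ y) ≤
      rdist g y z * (1 + C / m ^ 2 * rdist g y z) := by
  have hm := h.m_pos
  have hC := h.C_nonneg
  have hr := h.r_pos
  set φ := extChartAt 𝓘(ℝ, E) x₀ with hφ
  set N := chartNorm g x₀ (φ y) (φ z - φ y) with hN
  have hN0 : 0 ≤ N := chartNorm_nonneg _ _ _ _
  have hyz : rdist g y z < 2 * r := by
    have := rdist_triangle g y x₀ z
    rw [rdist_comm g y x₀] at this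
    linarith
  have key : ∀ ℓ, rdist g y z < ℓ → ℓ < 2 * r → N ≤ ℓ * (1 + C / m ^ 2 * ℓ) := by
    intro ℓ hℓ hℓr
    have hℓ0 : 0 < ℓ := (rdist_nonneg g y z).trans_lt hℓ
    obtain ⟨γ, hγ, γ0, γ1, hl, -⟩ := exists_path_of_rdist_lt g zero_lt_one hℓ
    have hsp := continuous_speed g hγ
    have i : ∀ a b, IntervalIntegrable (speed g γ univ) MeasureTheory.volume a b :=
      fun a b ↦ hsp.intervalIntegrable a b
    have hlen : ∀ s ∈ Icc (0 : ℝ) 1, ∫ τ in (0 : ℝ)..s, speed g γ univ τ ≤ ℓ := by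
      intro s hs
      have e1 := intervalIntegral.integral_add_adjacent_intervals (i 0 s) (i s 1)
      have e2 := intervalIntegral.integral_nonneg (μ := MeasureTheory.volume) hs.2
        (f := speed g γ univ)
        fun τ _ ↦ speed_nonneg g γ univ τ
      linarith
    -- The curve starts within `r` of `x₀` and is shorter than `2 * r`, so it does not leave the
    -- region controlled by the chart.
    have hγr : ∀ s ∈ Icc (0 : ℝ) 1, rdist g x₀ (γ s) < 4 * r := by
      intro s hs
      have e1 := rdist_le_integral_speed g hs.1 hγ
      have e2 := hlen s hs
      have e3 := rdist_triangle g x₀ y (γ s)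
      rw [γ0] at e1
      linarith
    let c' : ℝ → E := fun s ↦
      chartDeriv x₀ (γ s) (mfderivWithin 𝓘(ℝ, ℝ) 𝓘(ℝ, E) γ univ s (1 : ℝ))
    have hc : ∀ s ∈ Icc (0 : ℝ) 1, HasDerivAt (φ ∘ γ) (c' s) s := fun s hs ↦ by
      rw [← hasDerivWithinAt_univ]
      exact hasDerivWithinAt_extChartAt_comp
        (hγ.mdifferentiable one_ne_zero s).mdifferentiableWithinAt (h.mem_source _ (hγr s hs))
    have hspeed : ∀ s ∈ Icc (0 : ℝ) 1, speed g γ univ s = chartNorm g x₀ (φ (γ s)) (c' s) :=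
      fun s hs ↦ speed_eq_chartNorm g (h.mem_source _ (hγr s hs))
    have hc'le : ∀ s ∈ Icc (0 : ℝ) 1, ‖c' s‖ ≤ speed g γ univ s / m := by
      intro s hs
      rw [le_div_iff₀ hm, mul_comm, hspeed s hs]
      exact h.le_norm _ (h.mem_ball _ (hγr s hs)) _
    have hdisp : ∀ s ∈ Icc (0 : ℝ) 1, ‖φ (γ s) - φ y‖ ≤ ℓ / m := by
      intro s hs
      have hB : ∀ s, HasDerivAt (fun s ↦ (∫ τ in (0 : ℝ)..s, speed g γ univ τ) / m)
          (speed g γ univ s / m) s := fun s ↦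
        (hsp.integral_hasStrictDerivAt 0 s).hasDerivAt.div_const m
      have := image_norm_le_of_norm_deriv_right_le_deriv_boundary
        (f := fun s ↦ (φ ∘ γ) s - φ y) (f' := c') (a := 0) (b := 1)
        (fun s hs ↦ ((hc s hs).sub_const _).continuousAt.continuousWithinAt)
        (fun s hs ↦ ((hc s ⟨hs.1, hs.2.le⟩).sub_const _).hasDerivWithinAt)
        (by simp [γ0]) hB (fun s hs ↦ hc'le s ⟨hs.1, hs.2.le⟩) hs
      refine this.trans ?_
      have := hlen s hs
      gcongr
    have hyb : φ y ∈ Metric.ball (φ x₀) ρ := h.mem_ball y (by linarith)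
    -- Pairing the curve with the total displacement makes the problem scalar: by Cauchy–Schwarz the
    -- derivative of the pairing is controlled by the speed, and its total increase is `N ^ 2`.
    have hder : ∀ s ∈ Icc (0 : ℝ) 1, chartForm g x₀ (φ y) (φ z - φ y) (c' s) ≤
        N * (1 + C / m ^ 2 * ℓ) * speed g γ univ s := by
      intro s hs
      have e1 := chartForm_le_chartNorm_mul g (h.ball_subset hyb) (φ z - φ y) (c' s)
      have e2 := h.norm_le _ hyb _ (h.mem_ball _ (hγr s hs)) (c' s)
      rw [← hspeed s hs, norm_sub_rev] at e2
      have e3 : C * ‖φ (γ s) - φ y‖ * ‖c' s‖ ≤ C * (ℓ / m) * (speed g γ univ s / m) := by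
        have := hdisp s hs
        have := hc'le s hs
        gcongr
      calc _ ≤ N * chartNorm g x₀ (φ y) (c' s) := e1
        _ ≤ N * (speed g γ univ s + C * (ℓ / m) * (speed g γ univ s / m)) := by
            gcongr; exact e2.trans (by gcongr)
        _ = _ := by field_simp
    have hf : ∀ s ∈ Icc (0 : ℝ) 1, HasDerivAt
        (fun s ↦ chartForm g x₀ (φ y) (φ z - φ y) ((φ ∘ γ) s))
        (chartForm g x₀ (φ y) (φ z - φ y) (c' s)) s := fun s hs ↦
      (chartForm g x₀ (φ y) (φ z - φ y)).hasFDerivAt.comp_hasDerivAt s (hc s hs)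
    have hfin := intervalIntegral.sub_le_integral_of_hasDeriv_right_of_le
      (φ := fun s ↦ N * (1 + C / m ^ 2 * ℓ) * speed g γ univ s) zero_le_one
      (fun s hs ↦ (hf s hs).continuousAt.continuousWithinAt)
      (fun s hs ↦ (hf s ⟨hs.1.le, hs.2.le⟩).hasDerivWithinAt)
      (Continuous.continuousOn (by fun_prop)).integrableOn_Icc
      (fun s hs ↦ hder s ⟨hs.1.le, hs.2.le⟩)
    rw [intervalIntegral.integral_const_mul] at hfin
    simp only [Function.comp_apply, γ0, γ1, ← map_sub] at hfin
    rw [← chartNorm_sq g (h.ball_subset hyb), ← hN] at hfin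
    rcases hN0.eq_or_lt with h0 | h0
    · rw [← h0]; positivity
    · have e1 : N * N ≤ N * (ℓ * (1 + C / m ^ 2 * ℓ)) := by
        calc N * N = N ^ 2 := (sq N).symm
          _ ≤ _ := hfin
          _ ≤ N * (1 + C / m ^ 2 * ℓ) * ℓ := by gcongr
          _ = _ := by ring
      exact le_of_mul_le_mul_left e1 h0
  have hcont : Tendsto (fun ℓ : ℝ ↦ ℓ * (1 + C / m ^ 2 * ℓ)) (𝓝[>] (rdist g y z))
      (𝓝 (rdist g y z * (1 + C / m ^ 2 * rdist g y z))) :=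
    (Continuous.tendsto (by fun_prop) _).mono_left nhdsWithin_le_nhds
  refine ge_of_tendsto hcont ?_
  filter_upwards [self_mem_nhdsWithin, nhdsWithin_le_nhds (Iio_mem_nhds hyz)] with ℓ h1 h2
  exact key ℓ h1 h2

theorem ChartBounds.norm_sub_le (h : ChartBounds g x₀ ρ m C r) {y z : S}
    (hy : rdist g x₀ y < r) (hz : rdist g x₀ z < r) :
    ‖extChartAt 𝓘(ℝ, E) x₀ z - extChartAt 𝓘(ℝ, E) x₀ y‖ ≤
      rdist g y z * (1 + C / m ^ 2 * (2 * r)) / m := by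
  have hr := h.r_pos
  have hC := h.C_nonneg
  have hyz : rdist g y z ≤ 2 * r := by
    have := rdist_triangle g y x₀ z
    rw [rdist_comm g y x₀] at this
    linarith
  have hd := rdist_nonneg g y z
  rw [le_div_iff₀ h.m_pos, mul_comm]
  refine (h.le_norm _ (h.mem_ball y (by linarith)) _).trans
    ((h.chartNorm_sub_le hy hz).trans ?_)
  gcongr

/-- With `X = φ a - φ w` and `Y = φ b - φ w`, measured at `w`, both vectors have norm at most `k +
O(k ^ 2)` while `Y - X` has norm at least `2 * k - O(k ^ 2)`. The parallelogram law leaves `|X + Y|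
^ 2 = O(k ^ 3)`: midpoints are almost midpoints in the chart. -/
theorem ChartBounds.exists_second_difference_le (h : ChartBounds g x₀ ρ m C r) :
    ∃ K, ∀ a w b k, 0 < k → rdist g x₀ a < r → rdist g x₀ w < r → rdist g x₀ b < r →
      rdist g a w ≤ k → rdist g w b ≤ k → rdist g a b = 2 * k →
      ‖extChartAt 𝓘(ℝ, E) x₀ a + extChartAt 𝓘(ℝ, E) x₀ b -
        (2 : ℝ) • extChartAt 𝓘(ℝ, E) x₀ w‖ ≤ K * (k * √k) := by
  have hr := h.r_pos
  have hC := h.C_nonneg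
  have hm := h.m_pos
  set φ := extChartAt 𝓘(ℝ, E) x₀ with hφ
  set A := C / m ^ 2 with hA
  set B := (1 + A * (2 * r)) / m with hB
  have hA0 : 0 ≤ A := by positivity
  have hB0 : 0 ≤ B := by positivity
  set D := C * B ^ 2 with hD
  have hD0 : 0 ≤ D := by positivity
  set Q := 8 * A + 4 * A ^ 2 * r + 8 * D with hQ
  have hQ0 : 0 ≤ Q := by positivity
  refine ⟨√Q / m, fun a w b k hk ha hw hb haw hwb hab ↦ ?_⟩
  have hwB : φ w ∈ Metric.ball (φ x₀) ρ := h.mem_ball w (by linarith)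
  have hkr : k ≤ r := by
    have := rdist_triangle g a x₀ b
    rw [rdist_comm g a x₀] at this
    linarith
  have e1 : chartNorm g x₀ (φ w) (φ a - φ w) ≤ k * (1 + A * k) := by
    have e1 := h.chartNorm_sub_le hw ha
    have hd := rdist_nonneg g w a
    rw [rdist_comm] at haw
    refine e1.trans ?_
    gcongr
  have e2 : chartNorm g x₀ (φ w) (φ b - φ w) ≤ k * (1 + A * k) := by
    have e1 := h.chartNorm_sub_le hw hb
    have hd := rdist_nonneg g w b
    refine e1.trans ?_
    gcongr
  have n1 : ‖φ a - φ w‖ ≤ k * B := by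
    have := h.norm_sub_le hw ha
    rw [rdist_comm] at haw
    refine this.trans ?_
    rw [mul_div_assoc]
    gcongr
  have n2 : ‖φ b - φ w‖ ≤ k * B := by
    have := h.norm_sub_le hw hb
    refine this.trans ?_
    rw [mul_div_assoc]
    gcongr
  have n3 : ‖φ b - φ a‖ ≤ 2 * k * B := by
    have := h.norm_sub_le ha hb
    rwa [hab, mul_div_assoc] at this
  have e3 : 2 * k ≤ chartNorm g x₀ (φ w) (φ b - φ a) + 2 * D * k ^ 2 := by
    have := h.rdist_le ha hb hw n1 n2
    rw [hab] at this
    refine this.trans ?_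
    have : C * (k * B) * ‖φ b - φ a‖ ≤ C * (k * B) * (2 * k * B) := by gcongr
    rw [hD]
    linarith
  have hpar : chartNorm g x₀ (φ w) (φ a + φ b - (2 : ℝ) • φ w) ^ 2 =
      2 * chartNorm g x₀ (φ w) (φ a - φ w) ^ 2 + 2 * chartNorm g x₀ (φ w) (φ b - φ w) ^ 2 -
        chartNorm g x₀ (φ w) (φ b - φ a) ^ 2 := by
    simp only [chartNorm_sq g (h.ball_subset hwB), map_sub, map_add, map_smul, sub_apply,
      add_apply, smul_apply, smul_eq_mul]
    rw [chartForm_symm g (h.ball_subset hwB) (φ b) (φ a),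
      chartForm_symm g (h.ball_subset hwB) (φ w) (φ a),
      chartForm_symm g (h.ball_subset hwB) (φ w) (φ b)]
    ring
  have hfin : chartNorm g x₀ (φ w) (φ a + φ b - (2 : ℝ) • φ w) ^ 2 ≤ Q * k ^ 3 := by
    rw [hpar]
    have s1 := pow_le_pow_left₀ (chartNorm_nonneg g x₀ (φ w) (φ a - φ w)) e1 2
    have s2 := pow_le_pow_left₀ (chartNorm_nonneg g x₀ (φ w) (φ b - φ w)) e2 2
    -- Squaring `e3` directly would require `2 * k - 2 * D * k ^ 2` to be nonnegative; the tangent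
    -- line `4 * k * N - 4 * k ^ 2 ≤ N ^ 2` does not.
    have s3 : (2 * k) ^ 2 - 8 * D * k ^ 3 ≤ chartNorm g x₀ (φ w) (φ b - φ a) ^ 2 := by
      nlinarith [sq_nonneg (chartNorm g x₀ (φ w) (φ b - φ a) - 2 * k), mul_pos hk hk]
    have s4 : 4 * A ^ 2 * k ^ 4 ≤ 4 * A ^ 2 * r * k ^ 3 := by
      have : A ^ 2 * k ^ 3 * k ≤ A ^ 2 * k ^ 3 * r := by gcongr
      linarith
    rw [hQ]
    nlinarith
  have hle := h.le_norm _ hwB (φ a + φ b - (2 : ℝ) • φ w)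
  have hsq : chartNorm g x₀ (φ w) (φ a + φ b - (2 : ℝ) • φ w) ≤ √Q * (k * √k) := by
    refine le_of_sq_le_sq (hfin.trans_eq ?_) (by positivity)
    rw [mul_pow, mul_pow, Real.sq_sqrt hQ0, Real.sq_sqrt hk.le]
    ring
  rw [div_mul_eq_mul_div, le_div_iff₀ hm, mul_comm]
  exact hle.trans hsq

end chartDistance
-- Gluing and estimating piecewise curves
namespace Spacetime

variable {E : Type*} [NormedAddCommGroup E] [NormedSpace ℝ E]
  {H : Type*} [TopologicalSpace H] {I : ModelWithCorners ℝ E H}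
  {M : Type*} [TopologicalSpace M] [ChartedSpace H M]
  {C : ∀ p : M, TangentSpace I p → Prop} {γ : ℝ → M}

theorem isPiecewiseCurve_of_contMDiffOn {J : Set ℝ} (hJ : J.OrdConnected)
    (hγ : ContMDiffOn 𝓘(ℝ, ℝ) I 1 γ J)
    (hC : ∀ c ∈ J, ∀ d ∈ J, c < d → ∀ s ∈ Icc c d,
      C (γ s) (mfderivWithin 𝓘(ℝ, ℝ) I γ (Icc c d) s (1 : ℝ))) :
    IsPiecewiseCurve C γ J :=
  ⟨hJ, hγ.continuousOn, ∅, by simp, fun c hc d hd hcd _ ↦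
    ⟨hγ.mono (hJ.out hc hd), hC c hc d hd hcd⟩⟩

theorem isPiecewiseCurve_Icc_self (a : ℝ) : IsPiecewiseCurve C γ (Icc a a) := by
  refine ⟨ordConnected_Icc, by simp, ∅, by simp, fun c hc d hd hcd ↦ ?_⟩
  simp only [Icc_self, mem_singleton_iff] at hc hd
  exact absurd hcd (by simp [hc, hd])

theorem IsPiecewiseCurve.union {a b c : ℝ} (hab : a ≤ b) (hbc : b ≤ c)
    (h₁ : IsPiecewiseCurve C γ (Icc a b)) (h₂ : IsPiecewiseCurve C γ (Icc b c)) :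
    IsPiecewiseCurve C γ (Icc a c) := by
  obtain ⟨-, hc₁, D₁, hf₁, hD₁⟩ := h₁
  obtain ⟨-, hc₂, D₂, hf₂, hD₂⟩ := h₂
  -- The break sets are cut down because each is known to be finite only inside its own interval;
  -- the junction `b` becomes a break point.
  refine ⟨ordConnected_Icc, ?_, (D₁ ∩ Icc a b) ∪ (D₂ ∩ Icc b c) ∪ {b}, fun s _ t _ ↦ ?_, ?_⟩
  · rw [← Icc_union_Icc_eq_Icc hab hbc]
    exact hc₁.union_of_isClosed hc₂ isClosed_Icc isClosed_Icc
  · refine Finite.inter_of_left ?_ _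
    exact ((hf₁ a ⟨le_rfl, hab⟩ b ⟨hab, le_rfl⟩).union
      (hf₂ b ⟨le_rfl, hbc⟩ c ⟨hbc, le_rfl⟩)).union (finite_singleton b)
  · intro s hs t ht hst hdis
    have hb : b ∉ Ioo s t := fun hb ↦ disjoint_left.1 hdis (Or.inr rfl) hb
    rcases le_or_gt t b with htb | htb
    · exact hD₁ s ⟨hs.1, hst.le.trans htb⟩ t ⟨ht.1, htb⟩ hst (disjoint_left.2 fun x hx hx' ↦
        disjoint_left.1 hdis
          (Or.inl (Or.inl ⟨hx, hs.1.trans hx'.1.le, hx'.2.le.trans htb⟩)) hx')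
    · have hsb : b ≤ s := le_of_not_gt fun h ↦ hb ⟨h, htb⟩
      exact hD₂ s ⟨hsb, hs.2⟩ t ⟨htb.le, ht.2⟩ hst (disjoint_left.2 fun x hx hx' ↦
        disjoint_left.1 hdis
          (Or.inl (Or.inr ⟨hx, hsb.trans hx'.1.le, hx'.2.le.trans ht.2⟩)) hx')

theorem isPiecewiseCurve_of_locally {a b : ℝ} (hab : a ≤ b)
    (h : ∀ s₀ ∈ Icc a b, ∃ ε > 0, ∀ s t, a ≤ s → s < t → t ≤ b → s₀ - ε < s → t < s₀ + ε →
      IsPiecewiseCurve C γ (Icc s t)) : IsPiecewiseCurve C γ (Icc a b) := by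
  choose! ε hε hh using h
  obtain ⟨t, ht0, htm, ⟨N, hN⟩, hti⟩ := exists_monotone_Icc_subset_open_cover_Icc hab
    (c := fun s₀ : Icc a b ↦ {s : Icc a b | (s : ℝ) ∈ Ioo ((s₀ : ℝ) - ε s₀) (s₀ + ε s₀)})
    (fun s₀ ↦ isOpen_Ioo.preimage continuous_subtype_val)
    (fun s _ ↦ mem_iUnion.2 ⟨s, by
      have := hε s s.2
      exact ⟨by linarith, by linarith⟩⟩)
  have key : ∀ n, IsPiecewiseCurve C γ (Icc a (t n)) := by
    intro n
    induction n with
    | zero => rw [ht0]; exact isPiecewiseCurve_Icc_self a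
    | succ n ih =>
      have hle : (t n : ℝ) ≤ t (n + 1) := htm n.le_succ
      refine ih.union (t n).2.1 hle ?_
      rcases hle.eq_or_lt with he | hlt
      · rw [← he]; exact isPiecewiseCurve_Icc_self _
      · obtain ⟨s₀, hs₀⟩ := hti n
        have h1 := hs₀ ⟨le_rfl, htm n.le_succ⟩
        have h2 := hs₀ ⟨htm n.le_succ, le_rfl⟩
        exact hh s₀ s₀.2 _ _ (t n).2.1 hlt (t (n + 1)).2.2 h1.1 h2.2
  have := key N
  rwa [hN N le_rfl] at this

/-- Reduces estimates along piecewise curves to `C^1` pieces: a transitive relation is passed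
through the break points by induction on their number in the open interval. -/
theorem IsPiecewiseCurve.rel_of_lt {J : Set ℝ} (h : IsPiecewiseCurve C γ J) {R : ℝ → ℝ → Prop}
    (htrans : ∀ s ∈ J, ∀ t ∈ J, ∀ u ∈ J, s < t → t < u → R s t → R t u → R s u)
    (hR : ∀ c ∈ J, ∀ d ∈ J, c < d → ContMDiffOn 𝓘(ℝ, ℝ) I 1 γ (Icc c d) →
      (∀ s ∈ Icc c d, C (γ s) (mfderivWithin 𝓘(ℝ, ℝ) I γ (Icc c d) s (1 : ℝ))) → R c d)
    {c d : ℝ} (hc : c ∈ J) (hd : d ∈ J) (hcd : c < d) : R c d := by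
  obtain ⟨hJ, -, D, hDf, hD⟩ := h
  have hfin : ∀ c ∈ J, ∀ d ∈ J, (D ∩ Ioo c d).Finite := fun c hc d hd ↦
    (hDf c hc d hd).subset (inter_subset_inter_right _ Ioo_subset_Icc_self)
  induction hn : (D ∩ Ioo c d).ncard using Nat.strong_induction_on generalizing c d with
  | _ n ih =>
    by_cases hdis : Disjoint D (Ioo c d)
    · exact hR c hc d hd hcd (hD c hc d hd hcd hdis).1 (hD c hc d hd hcd hdis).2
    · obtain ⟨x, hxD, hx⟩ := not_disjoint_iff.1 hdis
      have hxJ : x ∈ J := hJ.out hc hd ⟨hx.1.le, hx.2.le⟩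
      refine htrans c hc x hxJ d hd hx.1 hx.2 (ih _ ?_ hc hxJ hx.1 rfl) (ih _ ?_ hxJ hd hx.2 rfl)
      · rw [← hn]
        refine ncard_lt_ncard ⟨fun y hy ↦ ⟨hy.1, hy.2.1, hy.2.2.trans hx.2⟩, fun hs ↦ ?_⟩
          (hfin c hc d hd)
        exact lt_irrefl x (hs ⟨hxD, hx⟩).2.2
      · rw [← hn]
        refine ncard_lt_ncard ⟨fun y hy ↦ ⟨hy.1, hx.1.trans hy.2.1, hy.2.2⟩, fun hs ↦ ?_⟩
          (hfin c hc d hd)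
        exact lt_irrefl x (hs ⟨hxD, hx⟩).2.1

end Spacetime

/-! ### Regularity of minimizing paths -/

section geodesic

variable {E : Type*} [NormedAddCommGroup E] [NormedSpace ℝ E] [FiniteDimensional ℝ E]
  {S : Type*} [TopologicalSpace S] [ChartedSpace E S] [IsManifold 𝓘(ℝ, E) ∞ S]
  [T3Space S] [ConnectedSpace S] {g : SmoothRiemannianMetric 𝓘(ℝ, E) S}

/-- In the chart centred at `σ s`, the speed is the limit of the norms of the difference quotients,
and `chartNorm_sub_le` bounds these by `1 + C / m ^ 2 * |t - s|`. -/
theorem speed_le_one_of_rdist_le {σ : ℝ → S} {a b : ℝ} (hab : a < b)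
    (hσ : ContMDiffOn 𝓘(ℝ, ℝ) 𝓘(ℝ, E) 1 σ (Icc a b))
    (hd : ∀ s ∈ Icc a b, ∀ t ∈ Icc a b, rdist g (σ s) (σ t) ≤ |t - s|) {s : ℝ}
    (hs : s ∈ Icc a b) : speed g σ (Icc a b) s ≤ 1 := by
  obtain ⟨ρ, m, C, r, h⟩ := exists_chartBounds g (σ s)
  have hr := h.r_pos
  have hC := h.C_nonneg
  have hm := h.m_pos
  have hsr : σ s ∈ (extChartAt 𝓘(ℝ, E) (σ s)).source := mem_extChartAt_source _
  have hder := hasDerivWithinAt_extChartAt_comp (hσ.mdifferentiableOn one_ne_zero s hs) hsr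
  rw [speed_eq_chartNorm g hsr]
  rw [hasDerivWithinAt_iff_tendsto_slope] at hder
  have hne : (𝓝[Icc a b \ {s}] s).NeBot := by
    have := uniqueDiffWithinAt_iff_accPt.1 (uniqueDiffOn_Icc hab s hs)
    rwa [accPt_principal_iff_nhdsWithin] at this
  have hcont : Continuous fun v ↦ chartNorm g (σ s) (extChartAt 𝓘(ℝ, E) (σ s) (σ s)) v := by
    unfold chartNorm; fun_prop
  have h1 := (hcont.tendsto _).comp hder
  have h2 : Tendsto (fun t : ℝ ↦ 1 + C / m ^ 2 * |t - s|) (𝓝[Icc a b \ {s}] s) (𝓝 1) := by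
    have : Tendsto (fun t : ℝ ↦ 1 + C / m ^ 2 * |t - s|) (𝓝 s) (𝓝 (1 + C / m ^ 2 * |s - s|)) :=
      Continuous.tendsto (by fun_prop) s
    simp only [sub_self, abs_zero, mul_zero, add_zero] at this
    exact this.mono_left nhdsWithin_le_nhds
  refine le_of_tendsto_of_tendsto h1 h2 ?_
  filter_upwards [self_mem_nhdsWithin,
    nhdsWithin_le_nhds (Metric.ball_mem_nhds s hr)] with t ht htr
  have hts : 0 < |t - s| := abs_pos.2 (sub_ne_zero.2 ht.2)
  rw [Metric.mem_ball, Real.dist_eq] at htr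
  have hdt := hd s hs t ht.1
  have h3 := h.chartNorm_sub_le (y := σ s) (z := σ t) (by rw [rdist_self]; exact hr)
    (hdt.trans_lt htr)
  simp only [Function.comp_apply, slope_def_module, chartNorm_smul, abs_inv]
  rw [inv_mul_le_iff₀ hts]
  refine h3.trans ?_
  have := rdist_nonneg g (σ s) (σ t)
  gcongr

/-- Three equally spaced points of an isometric path satisfy the hypotheses of
`exists_second_difference_le`. The resulting regularity theorem loses one end of the interval, so it
is applied forwards to one half and backwards to the other; the midpoint is allowed to be a break
point. -/
theorem ChartBounds.contMDiffOn_of_isometric {x₀ : S} {ρ m C r : ℝ}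
    (h : ChartBounds g x₀ ρ m C r) {σ : ℝ → S} {a b : ℝ} (hab : a < b)
    (hd : ∀ s t, a ≤ s → s ≤ t → t ≤ b → rdist g (σ s) (σ t) = t - s)
    (hr : ∀ s ∈ Icc a b, rdist g x₀ (σ s) < r) :
    ContMDiffOn 𝓘(ℝ, ℝ) 𝓘(ℝ, E) 1 σ (Icc a ((a + b) / 2)) ∧
      ContMDiffOn 𝓘(ℝ, ℝ) 𝓘(ℝ, E) 1 σ (Icc ((a + b) / 2) b) := by
  have hr0 := h.r_pos
  set φ := extChartAt 𝓘(ℝ, E) x₀ with hφ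
  have hσc : ContinuousOn σ (Icc a b) := by
    let _ := metricSpaceOf g
    refine LipschitzOnWith.continuousOn (K := 1) (LipschitzOnWith.of_dist_le_mul
      fun s hs t ht ↦ ?_)
    change rdist g (σ s) (σ t) ≤ 1 * dist s t
    rw [one_mul, Real.dist_eq]
    rcases le_total s t with hst | hst
    · rw [hd s t hs.1 hst ht.2, abs_sub_comm]; exact le_abs_self _
    · rw [rdist_comm, hd t s ht.1 hst hs.2]; exact le_abs_self _
  have hsrc : ∀ s ∈ Icc a b, σ s ∈ φ.source := fun s hs ↦
    h.mem_source _ (by linarith [hr s hs])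
  have hfc : ContinuousOn (fun s ↦ φ (σ s)) (Icc a b) :=
    (continuousOn_extChartAt x₀).comp hσc hsrc
  obtain ⟨K, hK⟩ := h.exists_second_difference_le
  have hsd : ∀ s k, a ≤ s → 0 < k → s + 2 * k ≤ b →
      ‖φ (σ s) + φ (σ (s + 2 * k)) - (2 : ℝ) • φ (σ (s + k))‖ ≤ K * (k * √k) := by
    intro s k hs hk hsk
    refine hK _ _ _ k hk (hr s ⟨hs, by linarith⟩) (hr _ ⟨by linarith, by linarith⟩)
      (hr _ ⟨by linarith, hsk⟩) ?_ ?_ ?_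
    · rw [hd s (s + k) hs (by linarith) (by linarith)]; linarith
    · rw [hd (s + k) (s + 2 * k) (by linarith) (by linarith) hsk]; linarith
    · rw [hd s (s + 2 * k) hs (by linarith) hsk]; linarith
  have fin : ∀ J ⊆ Icc a b, (∃ F : ℝ → E, ContDiff ℝ 1 F ∧ EqOn (fun s ↦ φ (σ s)) F J) →
      ContMDiffOn 𝓘(ℝ, ℝ) 𝓘(ℝ, E) 1 σ J := by
    rintro J hJ ⟨F, hF, hFe⟩
    have h1 : ContMDiffOn 𝓘(ℝ, ℝ) 𝓘(ℝ, E) 1 (φ.symm ∘ F) J :=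
      (contMDiffOn_extChartAt_symm x₀).comp hF.contMDiff.contMDiffOn fun s hs ↦ by
        rw [mem_preimage, ← hFe hs]
        exact φ.map_source (hsrc s (hJ hs))
    refine h1.congr fun s hs ↦ ?_
    rw [Function.comp_apply, ← hFe hs]
    exact (φ.left_inv (hsrc s (hJ hs))).symm
  exact ⟨fin _ (Icc_subset_Icc_right (by linarith))
      (exists_contDiff_one_eqOn_of_second_difference_le hfc (by linarith) (by linarith) hsd),
    fin _ (Icc_subset_Icc_left (by linarith))
      (exists_contDiff_one_eqOn_of_second_difference_le_right hfc (by linarith) (by linarith) hsd)⟩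

end geodesic
-- Causal relations of the static spacetime in terms of the conformal distance
section static

variable {E : Type*} [NormedAddCommGroup E] [NormedSpace ℝ E]
  {H : Type*} [TopologicalSpace H] {I : ModelWithCorners ℝ E H}
  {S : Type*} [TopologicalSpace S] [ChartedSpace H S]

theorem mfderivWithin_one_fst_snd {γ : ℝ → ℝ × S} {J : Set ℝ} {s : ℝ}
    (hγ : MDifferentiableWithinAt 𝓘(ℝ, ℝ) (𝓘(ℝ, ℝ).prod I) γ J s)
    (hJ : UniqueDiffWithinAt ℝ J s) :
    (mfderivWithin 𝓘(ℝ, ℝ) (𝓘(ℝ, ℝ).prod I) γ J s (1 : ℝ)).1 =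
      derivWithin (fun s ↦ (γ s).1) J s ∧
    (mfderivWithin 𝓘(ℝ, ℝ) (𝓘(ℝ, ℝ).prod I) γ J s (1 : ℝ)).2 =
      mfderivWithin 𝓘(ℝ, ℝ) I (fun s ↦ (γ s).2) J s (1 : ℝ) := by
  have h1 : MDifferentiableWithinAt 𝓘(ℝ, ℝ) 𝓘(ℝ, ℝ) (fun s ↦ (γ s).1) J s :=
    mdifferentiableAt_fst.comp_mdifferentiableWithinAt s hγ
  have h2 : MDifferentiableWithinAt 𝓘(ℝ, ℝ) I (fun s ↦ (γ s).2) J s :=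
    mdifferentiableAt_snd.comp_mdifferentiableWithinAt s hγ
  have h3 := mfderivWithin_prodMk h1 h2 hJ.uniqueMDiffWithinAt
  have h4 : mfderivWithin 𝓘(ℝ, ℝ) (𝓘(ℝ, ℝ).prod I) γ J s (1 : ℝ) =
      (mfderivWithin 𝓘(ℝ, ℝ) 𝓘(ℝ, ℝ) (fun s ↦ (γ s).1) J s (1 : ℝ),
        mfderivWithin 𝓘(ℝ, ℝ) I (fun s ↦ (γ s).2) J s (1 : ℝ)) := by
    exact congrArg (fun L : ℝ →L[ℝ] ℝ × E ↦ L 1) h3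
  rw [h4]
  refine ⟨?_, rfl⟩
  have h5 : mfderivWithin 𝓘(ℝ, ℝ) 𝓘(ℝ, ℝ) (fun s ↦ (γ s).1) J s =
      fderivWithin ℝ (fun s ↦ (γ s).1) J s := mfderivWithin_eq_fderivWithin
  exact (congrArg (fun L : ℝ →L[ℝ] ℝ ↦ L 1) h5).trans fderivWithin_derivWithin

variable [IsManifold I ∞ S] {g : SmoothRiemannianMetric I S} {β : S → ℝ}
  {hβ : ContMDiff I 𝓘(ℝ, ℝ) ∞ β} {hpos : ∀ x, 0 < β x}

theorem conformalMetric_inner (x : S) (u w : TangentSpace I x) :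
    (conformalMetric g β hβ hpos).inner x u w = (β x)⁻¹ * g.inner x u w := rfl

theorem speed_eq_sqrt_mul_speed_conformalMetric (γ : ℝ → S) (J : Set ℝ) (s : ℝ) :
    speed g γ J s = √(β (γ s)) * speed (conformalMetric g β hβ hpos) γ J s := by
  have hb := hpos (γ s)
  rw [speed, speed, ← Real.sqrt_mul hb.le, conformalMetric_inner,
    mul_inv_cancel_left₀ hb.ne']

theorem futureTimelike_iff (p : ℝ × S) (v : TangentSpace (𝓘(ℝ, ℝ).prod I) p) (τ : ℝ)
    (u : TangentSpace I p.2) (hτ : v.1 = τ) (hu : v.2 = u) :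
    (standardStatic g β hβ hpos).FutureTimelike p v ↔
      √((conformalMetric g β hβ hpos).inner p.2 u u) < τ := by
  have h1 : (standardStatic g β hβ hpos).inner p v v = -β p.2 * (τ * τ) + g.inner p.2 u u :=
    (staticForm_apply g β p v v).trans (by rw [hτ, hu])
  have h2 : (standardStatic g β hβ hpos).inner p ((standardStatic g β hβ hpos).timeField p) v =
      -β p.2 * τ := (staticForm_partialT g β p v).trans (by rw [hτ])
  have hb := hpos p.2
  have hg := inner_self_nonneg g p.2 u
  rw [Spacetime.FutureTimelike, h1, h2, conformalMetric_inner]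
  constructor
  · rintro ⟨h3, h4⟩
    have hτ0 : 0 < τ := by nlinarith
    rw [Real.sqrt_lt' hτ0, inv_mul_lt_iff₀ hb]
    nlinarith
  · intro h
    have hτ0 : 0 < τ := (Real.sqrt_nonneg _).trans_lt h
    rw [Real.sqrt_lt' hτ0, inv_mul_lt_iff₀ hb] at h
    exact ⟨by nlinarith, by nlinarith⟩

theorem futureCausal_iff (p : ℝ × S) (v : TangentSpace (𝓘(ℝ, ℝ).prod I) p) (τ : ℝ)
    (u : TangentSpace I p.2) (hτ : v.1 = τ) (hu : v.2 = u) :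
    (standardStatic g β hβ hpos).FutureCausal p v ↔
      0 < τ ∧ √((conformalMetric g β hβ hpos).inner p.2 u u) ≤ τ := by
  have h1 : (standardStatic g β hβ hpos).inner p v v = -β p.2 * (τ * τ) + g.inner p.2 u u :=
    (staticForm_apply g β p v v).trans (by rw [hτ, hu])
  have h2 : (standardStatic g β hβ hpos).inner p ((standardStatic g β hβ hpos).timeField p) v =
      -β p.2 * τ := (staticForm_partialT g β p v).trans (by rw [hτ])
  have hb := hpos p.2
  have hg := inner_self_nonneg g p.2 u
  rw [Spacetime.FutureCausal, h1, h2, conformalMetric_inner]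
  constructor
  · rintro ⟨-, h3, h4⟩
    have hτ0 : 0 < τ := by nlinarith
    rw [Real.sqrt_le_left hτ0.le, inv_mul_le_iff₀ hb]
    exact ⟨hτ0, by nlinarith⟩
  · rintro ⟨hτ0, h⟩
    rw [Real.sqrt_le_left hτ0.le, inv_mul_le_iff₀ hb] at h
    refine ⟨fun h0 ↦ ?_, by nlinarith, by nlinarith⟩
    rw [h0] at hτ
    exact hτ0.ne hτ

theorem futureTimelike_velocity_iff {γ : ℝ → ℝ × S} {J : Set ℝ} {s : ℝ}
    (hγ : MDifferentiableWithinAt 𝓘(ℝ, ℝ) (𝓘(ℝ, ℝ).prod I) γ J s)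
    (hJ : UniqueDiffWithinAt ℝ J s) :
    (standardStatic g β hβ hpos).FutureTimelike (γ s)
        (mfderivWithin 𝓘(ℝ, ℝ) (𝓘(ℝ, ℝ).prod I) γ J s (1 : ℝ)) ↔
      speed (conformalMetric g β hβ hpos) (fun s ↦ (γ s).2) J s <
        derivWithin (fun s ↦ (γ s).1) J s := by
  obtain ⟨h1, h2⟩ := mfderivWithin_one_fst_snd hγ hJ
  exact futureTimelike_iff _ _ _ _ h1 h2

theorem futureCausal_velocity_iff {γ : ℝ → ℝ × S} {J : Set ℝ} {s : ℝ}
    (hγ : MDifferentiableWithinAt 𝓘(ℝ, ℝ) (𝓘(ℝ, ℝ).prod I) γ J s)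
    (hJ : UniqueDiffWithinAt ℝ J s) :
    (standardStatic g β hβ hpos).FutureCausal (γ s)
        (mfderivWithin 𝓘(ℝ, ℝ) (𝓘(ℝ, ℝ).prod I) γ J s (1 : ℝ)) ↔
      0 < derivWithin (fun s ↦ (γ s).1) J s ∧
      speed (conformalMetric g β hβ hpos) (fun s ↦ (γ s).2) J s ≤
        derivWithin (fun s ↦ (γ s).1) J s := by
  obtain ⟨h1, h2⟩ := mfderivWithin_one_fst_snd hγ hJ
  exact futureCausal_iff _ _ _ _ h1 h2

theorem Spacetime.IsTimelikeCurve.isCausalCurve {M : Type*} [TopologicalSpace M]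
    [ChartedSpace H M] [IsManifold I ∞ M] {𝒮 : Spacetime I M} {γ : ℝ → M} {J : Set ℝ}
    (h : 𝒮.IsTimelikeCurve γ J) : 𝒮.IsCausalCurve γ J := by
  obtain ⟨h1, h2, D, h3, h4⟩ := h
  refine ⟨h1, h2, D, h3, fun c hc d hd hcd hD ↦
    ⟨(h4 c hc d hd hcd hD).1, fun s hs ↦ ?_⟩⟩
  obtain ⟨h5, h6⟩ := (h4 c hc d hd hcd hD).2 s hs
  exact ⟨fun h0 ↦ by rw [h0] at h5; simp at h5, h5.le, h6⟩

/-- A curve in `S` becomes timelike once its time component runs at any continuous rate exceeding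
the conformal speed. -/
theorem isTimelikeCurve_lift {x : ℝ → S} (hx : ContMDiff 𝓘(ℝ, ℝ) I 1 x) {w : ℝ → ℝ}
    (hw : Continuous w) (hlt : ∀ s, speed (conformalMetric g β hβ hpos) x univ s < w s)
    (t₀ s₀ : ℝ) {J : Set ℝ} (hJ : J.OrdConnected) :
    (standardStatic g β hβ hpos).IsTimelikeCurve (fun s ↦ (t₀ + ∫ τ in s₀..s, w τ, x s)) J := by
  have hd : ∀ s, HasDerivAt (fun s ↦ t₀ + ∫ τ in s₀..s, w τ) (w s) s := fun s ↦
    (hw.integral_hasStrictDerivAt s₀ s).hasDerivAt.const_add _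
  have ht : ContDiff ℝ 1 (fun s ↦ t₀ + ∫ τ in s₀..s, w τ) := by
    rw [contDiff_one_iff_deriv]
    refine ⟨fun s ↦ (hd s).differentiableAt, ?_⟩
    rw [show deriv (fun s ↦ t₀ + ∫ τ in s₀..s, w τ) = w from funext fun s ↦ (hd s).deriv]
    exact hw
  have hγ : ContMDiff 𝓘(ℝ, ℝ) (𝓘(ℝ, ℝ).prod I) 1 (fun s ↦ (t₀ + ∫ τ in s₀..s, w τ, x s)) :=
    ht.contMDiff.prodMk hx
  refine Spacetime.isPiecewiseCurve_of_contMDiffOn hJ hγ.contMDiffOn fun c _ d _ hcd s hs ↦ ?_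
  have hu := uniqueDiffOn_Icc hcd s hs
  rw [futureTimelike_velocity_iff (hγ.mdifferentiable one_ne_zero s).mdifferentiableWithinAt hu,
    speed_Icc_eq _ hcd (subset_univ _) hs
      (hx.mdifferentiable one_ne_zero s).mdifferentiableWithinAt,
    (hd s).hasDerivWithinAt.derivWithin hu]
  exact hlt s

variable [T3Space S] [ConnectedSpace S]

theorem Spacetime.IsCausalCurve.rdist_le {γ : ℝ → ℝ × S} {J : Set ℝ}
    (h : (standardStatic g β hβ hpos).IsCausalCurve γ J) {s t : ℝ} (hs : s ∈ J) (ht : t ∈ J)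
    (hst : s < t) : (γ s).1 < (γ t).1 ∧
      rdist (conformalMetric g β hβ hpos) (γ s).2 (γ t).2 ≤ (γ t).1 - (γ s).1 := by
  refine h.rel_of_lt (R := fun s t ↦ (γ s).1 < (γ t).1 ∧
    rdist (conformalMetric g β hβ hpos) (γ s).2 (γ t).2 ≤ (γ t).1 - (γ s).1) ?_ ?_ hs ht hst
  · rintro s - t - u - - - ⟨h1, h2⟩ ⟨h3, h4⟩
    exact ⟨h1.trans h3, (rdist_triangle _ _ (γ t).2 _).trans (by linarith)⟩
  · intro c _ d _ hcd hγ hv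
    have hu := uniqueDiffOn_Icc hcd
    have h1 : ContMDiffOn 𝓘(ℝ, ℝ) 𝓘(ℝ, ℝ) 1 (fun s ↦ (γ s).1) (Icc c d) :=
      contMDiff_fst.comp_contMDiffOn hγ
    have h2 : ContMDiffOn 𝓘(ℝ, ℝ) I 1 (fun s ↦ (γ s).2) (Icc c d) :=
      contMDiff_snd.comp_contMDiffOn hγ
    rw [contMDiffOn_iff_contDiffOn] at h1
    have hc := h1.continuousOn_derivWithin hu le_rfl
    have hint := intervalIntegral.integral_derivWithin_Icc_of_contDiffOn_Icc h1 hcd.le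
    have hv' := fun s hs ↦
      (futureCausal_velocity_iff (hγ.mdifferentiableOn one_ne_zero s hs) (hu s hs)).1 (hv s hs)
    constructor
    · have := intervalIntegral.intervalIntegral_pos_of_pos_on
        (hc.intervalIntegrable_of_Icc hcd.le)
        (fun s hs ↦ (hv' s ⟨hs.1.le, hs.2.le⟩).1) hcd
      rw [hint] at this
      linarith
    · have := rdist_le_of_speed_le (conformalMetric g β hβ hpos) hcd.le h2 hc
        fun s hs ↦ (hv' s hs).2
      rwa [hint] at this

theorem Spacetime.IsTimelikeCurve.rdist_lt {γ : ℝ → ℝ × S} {J : Set ℝ}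
    (h : (standardStatic g β hβ hpos).IsTimelikeCurve γ J) {s t : ℝ} (hs : s ∈ J) (ht : t ∈ J)
    (hst : s < t) :
    rdist (conformalMetric g β hβ hpos) (γ s).2 (γ t).2 < (γ t).1 - (γ s).1 := by
  refine h.rel_of_lt (R := fun s t ↦
    rdist (conformalMetric g β hβ hpos) (γ s).2 (γ t).2 < (γ t).1 - (γ s).1) ?_ ?_ hs ht hst
  · rintro s - t - u - - - h1 h2
    exact (rdist_triangle _ _ (γ t).2 _).trans_lt (by linarith)
  · intro c _ d _ hcd hγ hv
    have hu := uniqueDiffOn_Icc hcd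
    have h1 : ContMDiffOn 𝓘(ℝ, ℝ) 𝓘(ℝ, ℝ) 1 (fun s ↦ (γ s).1) (Icc c d) :=
      contMDiff_fst.comp_contMDiffOn hγ
    have h2 : ContMDiffOn 𝓘(ℝ, ℝ) I 1 (fun s ↦ (γ s).2) (Icc c d) :=
      contMDiff_snd.comp_contMDiffOn hγ
    rw [contMDiffOn_iff_contDiffOn] at h1
    have hc := h1.continuousOn_derivWithin hu le_rfl
    have hint := intervalIntegral.integral_derivWithin_Icc_of_contDiffOn_Icc h1 hcd.le
    have hv' := fun s hs ↦
      (futureTimelike_velocity_iff (hγ.mdifferentiableOn one_ne_zero s hs) (hu s hs)).1 (hv s hs)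
    have hcs := continuousOn_speed (conformalMetric g β hβ hpos) h2 hu
    have := rdist_le_of_speed_le (conformalMetric g β hβ hpos) hcd.le h2 hcs fun s _ ↦ le_rfl
    refine this.trans_lt ?_
    rw [← hint]
    exact intervalIntegral.integral_lt_integral_of_continuousOn_of_le_of_exists_lt hcd hcs hc
      (fun s hs ↦ (hv' s ⟨hs.1.le, hs.2⟩).le) ⟨c, ⟨le_rfl, hcd.le⟩, hv' c ⟨le_rfl, hcd.le⟩⟩

theorem chronological_iff {p q : ℝ × S} :
    (standardStatic g β hβ hpos).Chronological p q ↔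
      rdist (conformalMetric g β hβ hpos) p.2 q.2 < q.1 - p.1 := by
  constructor
  · rintro ⟨γ, a, b, hab, hγ, rfl, rfl⟩
    exact hγ.rdist_lt ⟨le_rfl, hab.le⟩ ⟨hab.le, le_rfl⟩ hab
  · intro h
    obtain ⟨x, hx, h0, h1, hl, -⟩ := exists_path_of_rdist_lt _ zero_lt_one h
    have hc := continuous_speed (conformalMetric g β hβ hpos) hx
    set ℓ := ∫ s in (0 : ℝ)..1, speed (conformalMetric g β hβ hpos) x univ s with hℓ
    -- The time left over by the length `ℓ` is spread evenly over the unit interval, so that the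
    -- curve arrives exactly at time `q.1`.
    refine ⟨_, 0, 1, zero_lt_one, isTimelikeCurve_lift hx
      (w := fun s ↦ speed (conformalMetric g β hβ hpos) x univ s + (q.1 - p.1 - ℓ))
      (by fun_prop) (fun s ↦ by linarith) p.1 0 ordConnected_Icc, ?_, ?_⟩
    · simp [h0]
    · have : ∫ s in (0 : ℝ)..1, (speed (conformalMetric g β hβ hpos) x univ s +
          (q.1 - p.1 - ℓ)) = q.1 - p.1 := by
        rw [intervalIntegral.integral_add (hc.intervalIntegrable _ _) (by simp), ← hℓ]
        simp
      simp only [this, h1]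
      ext <;> simp

theorem rdist_le_of_causal {p q : ℝ × S} (h : (standardStatic g β hβ hpos).Causal p q) :
    rdist (conformalMetric g β hβ hpos) p.2 q.2 ≤ q.1 - p.1 := by
  rcases h with rfl | ⟨γ, a, b, hab, hγ, rfl, rfl⟩
  · simp [rdist_self]
  · exact (hγ.rdist_le ⟨le_rfl, hab.le⟩ ⟨hab.le, le_rfl⟩ hab).2

theorem causal_of_rdist_lt {p q : ℝ × S}
    (h : rdist (conformalMetric g β hβ hpos) p.2 q.2 < q.1 - p.1) :
    (standardStatic g β hβ hpos).Causal p q := by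
  obtain ⟨γ, a, b, hab, hγ, h1, h2⟩ := chronological_iff.2 h
  exact Or.inr ⟨γ, a, b, hab, hγ.isCausalCurve, h1, h2⟩

end static
-- Causal continuity, strong causality, and the implications (A) → (B) → (C)
section causality

variable {E : Type*} [NormedAddCommGroup E] [NormedSpace ℝ E]
  {H : Type*} [TopologicalSpace H] {I : ModelWithCorners ℝ E H}
  {S : Type*} [TopologicalSpace S] [ChartedSpace H S] [IsManifold I ∞ S]
  [T3Space S] [ConnectedSpace S] {g : SmoothRiemannianMetric I S} {β : S → ℝ}
  {hβ : ContMDiff I 𝓘(ℝ, ℝ) ∞ β} {hpos : ∀ x, 0 < β x}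

theorem continuous_rdist_snd (h : SmoothRiemannianMetric I S) :
    Continuous fun z : (ℝ × S) × (ℝ × S) ↦ rdist h z.1.2 z.2.2 :=
  (continuous_rdist h).comp (by fun_prop : Continuous fun z : (ℝ × S) × (ℝ × S) ↦ (z.1.2, z.2.2))

/-- Points slightly above `q` lie in `I⁺(q)`; if `I⁺(p) = I⁺(q)`, letting them descend gives `d(p.2,
q.2) ≤ q.1 - p.1`. By symmetry the reverse inequality holds as well, and the two force `p = q`. -/
theorem isDistinguishing : (standardStatic g β hβ hpos).IsDistinguishing := by
  have hfin : ∀ p q : ℝ × S, rdist (conformalMetric g β hβ hpos) p.2 q.2 ≤ q.1 - p.1 →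
      rdist (conformalMetric g β hβ hpos) q.2 p.2 ≤ p.1 - q.1 → p = q := by
    intro p q h1 h2
    have h3 := rdist_nonneg (conformalMetric g β hβ hpos) p.2 q.2
    have h4 := rdist_nonneg (conformalMetric g β hβ hpos) q.2 p.2
    exact Prod.ext (by linarith) (eq_of_rdist_le_zero (conformalMetric g β hβ hpos) (by linarith))
  have hf : ∀ p q, (standardStatic g β hβ hpos).chronFuture p =
      (standardStatic g β hβ hpos).chronFuture q →
      rdist (conformalMetric g β hβ hpos) p.2 q.2 ≤ q.1 - p.1 := by
    intro p q h
    refine le_of_forall_pos_lt_add fun ε hε ↦ ?_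
    have h1 : (q.1 + ε, q.2) ∈ (standardStatic g β hβ hpos).chronFuture q :=
      chronological_iff.2 (by simp [rdist_self, hε])
    rw [← h] at h1
    have := chronological_iff.1 h1
    linarith
  have hp : ∀ p q, (standardStatic g β hβ hpos).chronPast p =
      (standardStatic g β hβ hpos).chronPast q →
      rdist (conformalMetric g β hβ hpos) p.2 q.2 ≤ q.1 - p.1 := by
    intro p q h
    refine le_of_forall_pos_lt_add fun ε hε ↦ ?_
    have h1 : (p.1 - ε, p.2) ∈ (standardStatic g β hβ hpos).chronPast p :=
      chronological_iff.2 (by simp [rdist_self, hε])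
    rw [h] at h1
    have := chronological_iff.1 h1
    linarith
  exact ⟨fun p q h ↦ hfin p q (hf p q h) (hf q p h.symm),
    fun p q h ↦ hfin p q (hp p q h) (hp q p h.symm)⟩

theorem closure_chronFuture (p : ℝ × S) :
    closure ((standardStatic g β hβ hpos).chronFuture p) =
      {q | rdist (conformalMetric g β hβ hpos) p.2 q.2 ≤ q.1 - p.1} := by
  have hc : Continuous fun q : ℝ × S ↦ rdist (conformalMetric g β hβ hpos) p.2 q.2 :=
    (continuous_rdist_snd _).comp (Continuous.prodMk_right p)
  refine (closure_minimal (fun q hq ↦ (chronological_iff.1 hq).le)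
    (isClosed_le hc (by fun_prop))).antisymm fun q hq ↦ ?_
  have ht : Tendsto (fun ε : ℝ ↦ (q.1 + ε, q.2)) (𝓝[>] 0) (𝓝 q) := by
    have : Tendsto (fun ε : ℝ ↦ (q.1 + ε, q.2)) (𝓝 0) (𝓝 (q.1 + 0, q.2)) :=
      Continuous.tendsto (by fun_prop) 0
    rw [add_zero] at this
    exact this.mono_left nhdsWithin_le_nhds
  refine mem_closure_of_tendsto ht ?_
  filter_upwards [self_mem_nhdsWithin] with ε (hε : 0 < ε)
  refine chronological_iff.2 ?_
  have hq' : rdist (conformalMetric g β hβ hpos) p.2 q.2 ≤ q.1 - p.1 := hq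
  dsimp only
  linarith

theorem closure_chronPast (p : ℝ × S) :
    closure ((standardStatic g β hβ hpos).chronPast p) =
      {q | rdist (conformalMetric g β hβ hpos) q.2 p.2 ≤ p.1 - q.1} := by
  have hc : Continuous fun q : ℝ × S ↦ rdist (conformalMetric g β hβ hpos) q.2 p.2 :=
    (continuous_rdist_snd _).comp (Continuous.prodMk_left p)
  refine (closure_minimal (fun q hq ↦ (chronological_iff.1 hq).le)
    (isClosed_le hc (by fun_prop))).antisymm fun q hq ↦ ?_
  have ht : Tendsto (fun ε : ℝ ↦ (q.1 - ε, q.2)) (𝓝[>] 0) (𝓝 q) := by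
    have : Tendsto (fun ε : ℝ ↦ (q.1 - ε, q.2)) (𝓝 0) (𝓝 (q.1 - 0, q.2)) :=
      Continuous.tendsto (by fun_prop) 0
    rw [sub_zero] at this
    exact this.mono_left nhdsWithin_le_nhds
  refine mem_closure_of_tendsto ht ?_
  filter_upwards [self_mem_nhdsWithin] with ε (hε : 0 < ε)
  refine chronological_iff.2 ?_
  have hq' : rdist (conformalMetric g β hβ hpos) q.2 p.2 ≤ p.1 - q.1 := hq
  dsimp only
  linarith

/-- The exterior of `I^±(p)` is given by a strict inequality between continuous functions of both
points, an open condition on pairs, so it persists near `{p} × K` for compact `K`. -/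
theorem isCausallyContinuous : (standardStatic g β hβ hpos).IsCausallyContinuous := by
  refine ⟨isDistinguishing, fun p K hK hKp ↦ ?_, fun p K hK hKp ↦ ?_⟩
  · have ho : IsOpen {z : (ℝ × S) × (ℝ × S) |
        z.2.1 - z.1.1 < rdist (conformalMetric g β hβ hpos) z.1.2 z.2.2} :=
      isOpen_lt (by fun_prop) (continuous_rdist_snd _)
    have := hK.eventually_forall_of_forall_eventually (x₀ := p)
      (P := fun p q ↦ q.1 - p.1 < rdist (conformalMetric g β hβ hpos) p.2 q.2) fun q hq ↦ by
        refine ho.mem_nhds ?_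
        have := hKp hq
        rw [closure_chronFuture, mem_compl_iff, mem_ofPred_eq] at this
        exact not_le.1 this
    filter_upwards [this] with p' hp' q hq
    rw [closure_chronFuture]
    exact not_le.2 (hp' q hq)
  · have ho : IsOpen {z : (ℝ × S) × (ℝ × S) |
        z.1.1 - z.2.1 < rdist (conformalMetric g β hβ hpos) z.1.2 z.2.2} :=
      isOpen_lt (by fun_prop) (continuous_rdist_snd _)
    have := hK.eventually_forall_of_forall_eventually (x₀ := p)
      (P := fun p q ↦ p.1 - q.1 < rdist (conformalMetric g β hβ hpos) p.2 q.2) fun q hq ↦ by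
        refine ho.mem_nhds ?_
        have := hKp hq
        rw [closure_chronPast, mem_compl_iff, mem_ofPred_eq] at this
        rw [mem_ofPred_eq, rdist_comm]
        exact not_le.1 this
    filter_upwards [this] with p' hp' q hq
    rw [closure_chronPast, mem_compl_iff, mem_ofPred_eq, rdist_comm]
    exact not_le.2 (hp' q hq)

theorem isStronglyCausal : (standardStatic g β hβ hpos).IsStronglyCausal := by
  intro p V hV
  set d := rdist (conformalMetric g β hβ hpos) with hd
  obtain ⟨A, hA, B, hB, hAB⟩ := mem_nhds_prod_iff.1 hV
  obtain ⟨a, ha, haA⟩ := Metric.mem_nhds_iff.1 hA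
  obtain ⟨b, hb, hbB⟩ := (@Metric.mem_nhds_iff S
    (metricSpaceOf (conformalMetric g β hβ hpos)).toPseudoMetricSpace _ _).1 hB
  refine ⟨{q | d p.2 q.2 + |q.1 - p.1| < min a b}, fun q hq ↦ hAB ⟨haA ?_, hbB ?_⟩, ?_, ?_, ?_⟩
  · rw [Metric.mem_ball, Real.dist_eq]
    have := rdist_nonneg (conformalMetric g β hβ hpos) p.2 q.2
    have h2 : d p.2 q.2 + |q.1 - p.1| < a := hq.trans_le (min_le_left _ _)
    linarith
  · change rdist (conformalMetric g β hβ hpos) q.2 p.2 < b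
    rw [rdist_comm]
    have := abs_nonneg (q.1 - p.1)
    have h2 : d p.2 q.2 + |q.1 - p.1| < b := hq.trans_le (min_le_right _ _)
    linarith
  · simp [hd, rdist_self, ha, hb]
  · have hc : Continuous fun q : ℝ × S ↦ d p.2 q.2 :=
      (continuous_rdist_snd _).comp (Continuous.prodMk_right p)
    exact isOpen_lt (hc.add (by fun_prop)) continuous_const
  · intro γ J hγ
    refine ⟨fun s hs t ht u hu ↦ ?_⟩
    have huJ : u ∈ J := hγ.1.out hs.1 ht.1 hu
    refine ⟨huJ, ?_⟩
    rcases hu.1.eq_or_lt with rfl | hsu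
    · exact hs.2
    rcases hu.2.eq_or_lt with rfl | hut
    · exact ht.2
    obtain ⟨h1, h2⟩ := hγ.rdist_le hs.1 huJ hsu
    obtain ⟨h3, h4⟩ := hγ.rdist_le huJ ht.1 hut
    have hs2 : d p.2 (γ s).2 + |(γ s).1 - p.1| < min a b := hs.2
    have ht2 : d p.2 (γ t).2 + |(γ t).1 - p.1| < min a b := ht.2
    have h5 := rdist_triangle (conformalMetric g β hβ hpos) p.2 (γ s).2 (γ u).2
    have h6 := rdist_triangle (conformalMetric g β hβ hpos) p.2 (γ t).2 (γ u).2
    rw [rdist_comm _ (γ t).2 (γ u).2] at h6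
    change d p.2 (γ u).2 + |(γ u).1 - p.1| < min a b
    -- Along a causal curve `d` changes by at most the elapsed time. Hence before time `p.1` the
    -- value of `d + |t - p.1|` at `u` is at most that at `s`, and after it at most that at `t`.
    rcases le_total (γ u).1 p.1 with hle | hle
    · rw [abs_of_nonpos (sub_nonpos.2 hle)]
      have := neg_le_abs ((γ s).1 - p.1)
      linarith
    · rw [abs_of_nonneg (sub_nonneg.2 hle)]
      have := le_abs_self ((γ t).1 - p.1)
      linarith

theorem tendsto_of_cauchySeq_of_isCompact (h : SmoothRiemannianMetric I S) {u : ℕ → S}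
    (hu : @CauchySeq S ℕ (metricSpaceOf h).toUniformSpace _ u) {K : Set S} (hK : IsCompact K)
    {N : ℕ} (hN : ∀ n ≥ N, u n ∈ K) : ∃ x, Tendsto u atTop (𝓝 x) := by
  let _ := metricSpaceOf h
  obtain ⟨x, -, hx⟩ := cauchySeq_tendsto_of_isComplete hK.isComplete
    (u := fun n ↦ u (n + N)) (fun n ↦ hN _ (Nat.le_add_left _ _))
    (hu.comp_tendsto (tendsto_add_atTop_nat N))
  exact ⟨x, (tendsto_add_atTop_iff_nat N).1 hx⟩

theorem exists_forall_ge_rdist_lt (h : SmoothRiemannianMetric I S) {u : ℕ → S}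
    (hu : @CauchySeq S ℕ (metricSpaceOf h).toUniformSpace _ u) {ε : ℝ} (hε : 0 < ε) :
    ∃ N, ∀ m ≥ N, ∀ n ≥ N, rdist h (u m) (u n) < ε :=
  (@Metric.cauchySeq_iff S ℕ (metricSpaceOf h).toPseudoMetricSpace _ _ u).1 hu ε hε

theorem isCompleteMetric_of_isGloballyHyperbolic
    (h : (standardStatic g β hβ hpos).IsGloballyHyperbolic) :
    IsCompleteMetric (conformalMetric g β hβ hpos) := by
  intro u hu
  have hu' := cauchySeq_of_riemannianDist hu
  obtain ⟨N, hN⟩ := exists_forall_ge_rdist_lt _ hu' one_pos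
  have hK := (h.2 (-1, u N) (1, u N)).image continuous_snd
  refine tendsto_of_cauchySeq_of_isCompact _ hu' hK (N := N) fun n hn ↦
    ⟨(0, u n), ⟨causal_of_rdist_lt ?_, causal_of_rdist_lt ?_⟩, rfl⟩
  · simpa using hN N le_rfl n hn
  · simpa using hN n hn N le_rfl

theorem isCauchyHypersurface_of_isCompleteMetric
    (h : IsCompleteMetric (conformalMetric g β hβ hpos)) (c : ℝ) :
    (standardStatic g β hβ hpos).IsCauchyHypersurface {p : ℝ × S | p.1 = c} := by
  rintro γ J ⟨hγ, htop, hbot⟩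
  have hcomp := completeSpace_of_isCompleteMetric h
  -- The empty curve is not inextendible: its end filters are trivial and converge to every point.
  have hJne : Nonempty J := by
    by_contra hne
    rw [not_nonempty_iff] at hne
    obtain ⟨x⟩ : Nonempty S := inferInstance
    refine htop (0, x) ?_
    rw [show (atTop : Filter J) = ⊥ from Filter.filter_eq_bot_of_isEmpty _]
    exact tendsto_bot
  have hmono : StrictMono fun s : J ↦ (γ s).1 := fun s t hst ↦ (hγ.rdist_le s.2 t.2 hst).1
  have hle : ∀ s t : J, rdist (conformalMetric g β hβ hpos) (γ s).2 (γ t).2 ≤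
      |(γ s).1 - (γ t).1| := by
    intro s t
    rcases lt_trichotomy s t with hst | rfl | hst
    · rw [abs_sub_comm]
      exact (hγ.rdist_le s.2 t.2 hst).2.trans (le_abs_self _)
    · simp [rdist_self]
    · rw [rdist_comm]
      exact (hγ.rdist_le t.2 s.2 hst).2.trans (le_abs_self _)
  -- Distances in `S` are dominated by time differences, so convergence of the time makes the
  -- `S`-component Cauchy.
  have hlim : ∀ F : Filter J, F.NeBot → (∃ T, Tendsto (fun s : J ↦ (γ s).1) F (𝓝 T)) →
      ∃ p, Tendsto (fun s : J ↦ γ s) F (𝓝 p) := by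
    rintro F hF ⟨T, hT⟩
    let _ := metricSpaceOf (conformalMetric g β hβ hpos)
    have hcF : Cauchy (map (fun s : J ↦ (γ s).1) F) := hT.cauchy_map
    have hcF' : Cauchy (map (fun s : J ↦ (γ s).2) F) := by
      rw [Metric.cauchy_iff] at hcF ⊢
      refine ⟨inferInstance, fun ε hε ↦ ?_⟩
      obtain ⟨t, ht, htε⟩ := hcF.2 ε hε
      refine ⟨(fun s : J ↦ (γ s).2) '' ((fun s : J ↦ (γ s).1) ⁻¹' t), image_mem_map ht, ?_⟩
      rintro _ ⟨s, hs, rfl⟩ _ ⟨s', hs', rfl⟩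
      exact (hle s s').trans_lt (htε _ hs _ hs')
    obtain ⟨x, hx⟩ := CompleteSpace.complete hcF'
    exact ⟨(T, x), hT.prodMk_nhds hx⟩
  have habove : ∃ s : J, c < (γ s).1 := by
    by_contra! hb
    have hbdd : BddAbove (range fun s : J ↦ (γ s).1) := ⟨c, by rintro _ ⟨s, rfl⟩; exact hb s⟩
    obtain ⟨p, hp⟩ := hlim atTop inferInstance ⟨_, tendsto_atTop_ciSup hmono.monotone hbdd⟩
    exact htop p hp
  have hbelow : ∃ s : J, (γ s).1 < c := by
    by_contra! hb
    have hbdd : BddBelow (range fun s : J ↦ (γ s).1) := ⟨c, by rintro _ ⟨s, rfl⟩; exact hb s⟩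
    obtain ⟨p, hp⟩ := hlim atBot inferInstance ⟨_, tendsto_atBot_ciInf hmono.monotone hbdd⟩
    exact hbot p hp
  obtain ⟨s₁, h₁⟩ := habove
  obtain ⟨s₀, h₀⟩ := hbelow
  have hlt : (s₀ : ℝ) < s₁ := hmono.lt_iff_lt.1 (h₀.trans h₁)
  have hsub : Icc (s₀ : ℝ) s₁ ⊆ J := hγ.1.out s₀.2 s₁.2
  have hcont : ContinuousOn (fun s ↦ (γ s).1) (Icc (s₀ : ℝ) s₁) :=
    continuous_fst.comp_continuousOn (hγ.2.1.mono hsub)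
  obtain ⟨s, hs, hsc⟩ := intermediate_value_Icc hlt.le hcont ⟨h₀.le, h₁.le⟩
  refine ⟨s, ⟨hsub hs, hsc⟩, fun t ht ↦ ?_⟩
  have := hmono.injective (a₁ := ⟨t, ht.1⟩) (a₂ := ⟨s, hsub hs⟩) (ht.2.trans hsc.symm)
  exact congrArg Subtype.val this

end causality
-- Completeness of the conformal metric: from (C), and for at most quadratic `β`
section completeness

variable {E : Type*} [NormedAddCommGroup E] [NormedSpace ℝ E]
  {H : Type*} [TopologicalSpace H] {I : ModelWithCorners ℝ E H}
  {S : Type*} [TopologicalSpace S] [ChartedSpace H S] [IsManifold I ∞ S]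
  [T3Space S] [ConnectedSpace S] {g : SmoothRiemannianMetric I S} {β : S → ℝ}
  {hβ : ContMDiff I 𝓘(ℝ, ℝ) ∞ β} {hpos : ∀ x, 0 < β x}

/-- Infinitely many points at summable distances lie on one `C^1` curve of finite length. -/
theorem exists_contMDiff_of_rdist_lt (h : SmoothRiemannianMetric I S) {u : ℕ → S}
    (hu : ∀ m n, m ≤ n → rdist h (u m) (u n) < (1 / 2) ^ m) :
    ∃ x : ℝ → S, ContMDiff 𝓘(ℝ, ℝ) I 1 x ∧ (∀ n : ℕ, x n = u n) ∧
      ∀ n : ℕ, ∫ s in (0 : ℝ)..n, speed h x univ s ≤ 2 := by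
  -- Indexing by `ℤ` makes the curve `C^1` on all of `ℝ`; for negative `k`, `toNat` is `0` and the
  -- pieces are loops at `u 0`.
  have hpath : ∀ k : ℤ, ∃ γ : ℝ → S, ContMDiff 𝓘(ℝ, ℝ) I 1 γ ∧
      ∫ s in (k : ℝ)..(k + 1), speed h γ univ s < (1 / 2) ^ k.toNat ∧
      γ =ᶠ[𝓝 (k : ℝ)] (fun _ ↦ u k.toNat) ∧
      γ =ᶠ[𝓝 ((k : ℝ) + 1)] (fun _ ↦ u (k + 1).toNat) := by
    intro k
    obtain ⟨γ, h1, -, -, h2, h3, h4⟩ := exists_path_of_rdist_lt h (lt_add_one (k : ℝ))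
      (hu k.toNat (k + 1).toNat (Int.toNat_le_toNat (by lia)))
    exact ⟨γ, h1, h2, h3, h4⟩
  choose γ hγ hl h0 h1 using hpath
  let x : ℝ → S := fun s ↦ γ ⌊s⌋ s
  have hfloor : ∀ (k : ℤ) (s : ℝ), s ∈ Ioo (k : ℝ) (k + 1) → ⌊s⌋ = k := fun k s hs ↦
    Int.floor_eq_iff.2 ⟨hs.1.le, hs.2⟩
  have hx_Ioo : ∀ (k : ℤ), ∀ s ∈ Ioo (k : ℝ) (k + 1), x =ᶠ[𝓝 s] γ k := by
    intro k s hs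
    filter_upwards [Ioo_mem_nhds hs.1 hs.2] with t ht
    simp only [x, hfloor k t ht]
  have hx_int : ∀ k : ℤ, x =ᶠ[𝓝 (k : ℝ)] fun _ ↦ u k.toNat := by
    intro k
    have h2 := h1 (k - 1)
    rw [Int.cast_sub, Int.cast_one, sub_add_cancel, sub_add_cancel] at h2
    filter_upwards [h0 k, h2, Ioo_mem_nhds (sub_one_lt (k : ℝ)) (lt_add_one (k : ℝ))]
      with s hs1 hs2 hs
    rcases lt_or_ge s k with hsk | hsk
    · have : ⌊s⌋ = k - 1 := Int.floor_eq_iff.2 ⟨by push_cast; exact hs.1.le, by simpa using hsk⟩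
      simp only [x, this, hs2]
    · have : ⌊s⌋ = k := Int.floor_eq_iff.2 ⟨hsk, hs.2⟩
      simp only [x, this, hs1]
  have hx : ContMDiff 𝓘(ℝ, ℝ) I 1 x := by
    intro s
    rcases (Int.floor_le s).eq_or_lt with he | hlt
    · rw [← he]
      exact contMDiffAt_const.congr_of_eventuallyEq (hx_int _)
    · exact (hγ ⌊s⌋ s).congr_of_eventuallyEq (hx_Ioo ⌊s⌋ s ⟨hlt, Int.lt_floor_add_one s⟩)
  have hc := continuous_speed h hx
  have hpiece : ∀ k : ℤ, ∫ s in (k : ℝ)..(k + 1), speed h x univ s ≤ (1 / 2) ^ k.toNat := by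
    intro k
    have heq : EqOn (speed h x univ) (speed h (γ k) univ) (Icc (k : ℝ) (k + 1)) := by
      rw [← closure_Ioo (lt_add_one (k : ℝ)).ne]
      refine EqOn.closure (fun s hs ↦ ?_) hc (continuous_speed h (hγ k))
      have h2 := hx_Ioo k s hs
      simp only [speed, mfderivWithin_univ, h2.mfderiv_eq]
      let v : E := mfderiv 𝓘(ℝ, ℝ) I (γ k) s (1 : ℝ)
      exact congrArg (fun y : S ↦ √((h.inner y : E →L[ℝ] E →L[ℝ] ℝ) v v)) h2.eq_of_nhds
    rw [intervalIntegral.integral_congr (g := speed h (γ k) univ)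
      (by rw [uIcc_of_le (lt_add_one (k : ℝ)).le]; exact heq)]
    exact (hl k).le
  refine ⟨x, hx, fun n ↦ ?_, fun n ↦ ?_⟩
  · have := (hx_int n).eq_of_nhds
    simpa using this
  · have key : ∀ n : ℕ, ∫ s in (0 : ℝ)..n, speed h x univ s ≤ 2 - 2 * (1 / 2) ^ n := by
      intro n
      induction n with
      | zero => simp
      | succ n ih =>
        have e := intervalIntegral.integral_add_adjacent_intervals
          (hc.intervalIntegrable (μ := MeasureTheory.volume) 0 n)
          (hc.intervalIntegrable (n : ℝ) (n + 1))
        have e2 := hpiece n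
        simp only [Int.cast_natCast, Int.toNat_natCast] at e2
        rw [Nat.cast_succ, ← e, pow_succ]
        linarith
    have := key n
    have h3 : (0 : ℝ) < (1 / 2) ^ n := by positivity
    linarith

/-- A fast subsequence of a nonconvergent Cauchy sequence is threaded on a curve of finite length.
Its timelike lift has no future endpoint, since one would provide a limit of the sequence, but its
time stays bounded above. -/
theorem isCompleteMetric_of_isCauchyHypersurface
    (h : ∀ c : ℝ, (standardStatic g β hβ hpos).IsCauchyHypersurface {p : ℝ × S | p.1 = c}) :
    IsCompleteMetric (conformalMetric g β hβ hpos) := by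
  intro u hu
  set gc := conformalMetric g β hβ hpos with hgc
  have hu' := cauchySeq_of_riemannianDist hu
  obtain ⟨φ, hφ, hφu⟩ := extraction_forall_of_eventually'
    (P := fun n k ↦ ∀ m ≥ k, rdist gc (u k) (u m) < (1 / 2) ^ n) (fun n ↦ by
      obtain ⟨N, hN⟩ := exists_forall_ge_rdist_lt gc hu' (ε := (1 / 2) ^ n) (by positivity)
      exact ⟨N, fun k hk m hm ↦ hN k hk m (hk.trans hm)⟩)
  obtain ⟨x, hx, hxu, hxl⟩ := exists_contMDiff_of_rdist_lt gc (u := u ∘ φ)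
    fun m n hmn ↦ hφu m _ (hφ.monotone hmn)
  have hc := continuous_speed gc hx
  -- The term `exp (-s)` makes the lift strictly timelike. It adds at most `1` to the time in the
  -- future, which with the length bound `2` gives `3`, and it sends the time to `-∞` in the past,
  -- excluding a past endpoint.
  let w : ℝ → ℝ := fun s ↦ speed gc x univ s + Real.exp (-s)
  have hw : Continuous w := by fun_prop
  have hw0 : ∀ s, 0 < w s := fun s ↦
    add_pos_of_nonneg_of_pos (speed_nonneg _ _ _ _) (Real.exp_pos _)
  have hcurve := isTimelikeCurve_lift (g := g) (hβ := hβ) (hpos := hpos) hx hw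
    (fun s ↦ lt_add_of_pos_right _ (Real.exp_pos _)) 0 0 (J := univ) ordConnected_univ
  have hexp : ∀ s : ℝ, ∫ τ in (0 : ℝ)..s, Real.exp (-τ) = 1 - Real.exp (-s) := by
    intro s
    rw [intervalIntegral.integral_comp_neg]
    simp
  have hsplit : ∀ s : ℝ, ∫ τ in (0 : ℝ)..s, w τ =
      (∫ τ in (0 : ℝ)..s, speed gc x univ τ) + (1 - Real.exp (-s)) := by
    intro s
    rw [← hexp s]
    exact intervalIntegral.integral_add (hc.intervalIntegrable _ _)
      (Continuous.intervalIntegrable (by fun_prop) _ _)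
  have habove : ∀ s, ∫ τ in (0 : ℝ)..s, w τ ≤ 3 := by
    intro s
    obtain ⟨n, hn⟩ := exists_nat_ge s
    have e1 := intervalIntegral.integral_add_adjacent_intervals
      (hw.intervalIntegrable (μ := MeasureTheory.volume) 0 s) (hw.intervalIntegrable s n)
    have e2 := intervalIntegral.integral_nonneg (μ := MeasureTheory.volume) hn
      (f := w) fun τ _ ↦ (hw0 τ).le
    have e3 := hxl n
    have e4 := hsplit n
    have := Real.exp_pos (-(n : ℝ))
    linarith
  have hbelow : ∀ n : ℕ, ∫ τ in (0 : ℝ)..(-(n : ℝ)), w τ ≤ -n := by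
    intro n
    have e1 := hsplit (-(n : ℝ))
    have e2 : ∫ τ in (0 : ℝ)..(-(n : ℝ)), speed gc x univ τ ≤ 0 := by
      rw [intervalIntegral.integral_symm]
      have := intervalIntegral.integral_nonneg (μ := MeasureTheory.volume)
        (show -(n : ℝ) ≤ 0 by simp) (f := speed gc x univ)
        fun τ _ ↦ speed_nonneg _ _ _ _
      linarith
    have e3 := Real.add_one_le_exp (n : ℝ)
    rw [neg_neg] at e1
    linarith
  by_contra hno
  have hinext : (standardStatic g β hβ hpos).IsInextendibleCausalCurve
      (fun s ↦ (0 + ∫ τ in (0 : ℝ)..s, w τ, x s)) univ := by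
    refine ⟨hcurve.isCausalCurve, fun p hp ↦ hno ⟨p.2, ?_⟩, fun p hp ↦ ?_⟩
    · have hnat : Tendsto (fun n : ℕ ↦ (⟨n, mem_univ _⟩ : (univ : Set ℝ))) atTop atTop :=
        tendsto_atTop.2 fun b ↦ (tendsto_natCast_atTop_atTop (R := ℝ)).eventually_ge_atTop b
      have h1 := (continuous_snd.tendsto p).comp (hp.comp hnat)
      have h2 : Tendsto (u ∘ φ) atTop (𝓝 p.2) := h1.congr fun n ↦ hxu n
      let _ := metricSpaceOf gc
      exact tendsto_nhds_of_cauchySeq_of_subseq hu' hφ.tendsto_atTop h2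
    · have hnat : Tendsto (fun n : ℕ ↦ (⟨-(n : ℝ), mem_univ _⟩ : (univ : Set ℝ))) atTop atBot :=
        tendsto_atBot.2 fun b ↦ (tendsto_neg_atTop_atBot.comp
          (tendsto_natCast_atTop_atTop (R := ℝ))).eventually_le_atBot b
      have h1 := (continuous_fst.tendsto p).comp (hp.comp hnat)
      refine not_tendsto_nhds_of_tendsto_atBot ?_ _ h1
      refine tendsto_atBot_mono (fun n ↦ ?_) (tendsto_neg_atTop_atBot.comp
          (tendsto_natCast_atTop_atTop (R := ℝ)))
      simpa using hbelow n
  obtain ⟨s, ⟨-, hs⟩, -⟩ := h 4 _ _ hinext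
  have h4 : 0 + ∫ τ in (0 : ℝ)..s, w τ = 4 := hs
  linarith [habove s]

/-- A Gronwall estimate: the distance of `g` to a fixed point grows at most exponentially with the
distance of `g / β` if `β` is at most quadratic. -/
theorem one_add_rdist_le_of_rdist_conformalMetric_lt {x₀ : S} {B r : ℝ} (hB : 0 ≤ B)
    (hβB : ∀ x, β x ≤ B * (1 + rdist g x₀ x) ^ 2) {x y : S}
    (hxy : rdist (conformalMetric g β hβ hpos) x y < r) :
    1 + rdist g x₀ y ≤ (1 + rdist g x₀ x) * Real.exp (√B * r) := by
  set gc := conformalMetric g β hβ hpos with hgc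
  obtain ⟨γ, hγ, h0, h1, hl, -⟩ := exists_path_of_rdist_lt gc zero_lt_one hxy
  have hc := continuous_speed gc hγ
  have hcg := continuous_speed g hγ
  let f : ℝ → ℝ := fun s ↦ 1 + rdist g x₀ (γ s)
  have hf : Continuous f := continuous_const.add
    ((continuous_rdist g).comp (continuous_const.prodMk hγ.continuous))
  have hf0 : ∀ s, 0 ≤ f s := fun s ↦ add_nonneg zero_le_one (rdist_nonneg _ _ _)
  let k : ℝ → ℝ := fun s ↦ √B * f s * speed gc γ univ s
  have hk : Continuous k := by fun_prop
  let F : ℝ → ℝ := fun s ↦ f 0 + ∫ τ in (0 : ℝ)..s, k τ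
  let L : ℝ → ℝ := fun s ↦ ∫ τ in (0 : ℝ)..s, speed gc γ univ τ
  have hF : ∀ s, HasDerivAt F (k s) s := fun s ↦
    (hk.integral_hasStrictDerivAt 0 s).hasDerivAt.const_add _
  have hL : ∀ s, HasDerivAt L (speed gc γ univ s) s := fun s ↦
    (hc.integral_hasStrictDerivAt 0 s).hasDerivAt
  have hsp : ∀ s, speed g γ univ s ≤ k s := by
    intro s
    rw [speed_eq_sqrt_mul_speed_conformalMetric (hβ := hβ) (hpos := hpos)]
    refine mul_le_mul_of_nonneg_right ?_ (speed_nonneg _ _ _ _)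
    refine (Real.sqrt_le_sqrt (hβB (γ s))).trans_eq ?_
    rw [Real.sqrt_mul hB, Real.sqrt_sq (hf0 s)]
  have hfF : ∀ s, 0 ≤ s → f s ≤ F s := by
    intro s hs
    have e1 := rdist_le_integral_speed g hs hγ
    have e2 := intervalIntegral.integral_mono_on hs
      (hcg.intervalIntegrable (μ := MeasureTheory.volume) 0 s)
      (hk.intervalIntegrable 0 s) fun τ _ ↦ hsp τ
    have e3 := rdist_triangle g x₀ (γ 0) (γ s)
    simp only [f, F]
    linarith
  -- The integrating factor: `F' = √B * f * L'` and `f ≤ F`, so `G` does not increase.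
  let G : ℝ → ℝ := fun s ↦ F s * Real.exp (-(√B * L s))
  have hG : ∀ s, HasDerivAt G (k s * Real.exp (-(√B * L s)) +
      F s * (Real.exp (-(√B * L s)) * -(√B * speed gc γ univ s))) s := fun s ↦
    (hF s).mul ((hL s).const_mul (√B)).neg.exp
  have hanti : AntitoneOn G (Icc 0 1) := by
    refine antitoneOn_of_deriv_nonpos (convex_Icc 0 1)
      (fun s _ ↦ (hG s).continuousAt.continuousWithinAt)
      (fun s _ ↦ (hG s).differentiableAt.differentiableWithinAt) fun s hs ↦ ?_
    rw [interior_Icc] at hs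
    rw [(hG s).deriv]
    have e1 := hfF s hs.1.le
    have e2 : 0 ≤ √B * speed gc γ univ s * Real.exp (-(√B * L s)) := by
      have := speed_nonneg gc γ univ s
      positivity
    have e3 := mul_le_mul_of_nonneg_left e1 e2
    simp only [k]
    linarith
  have hfin := hanti (left_mem_Icc.2 zero_le_one) (right_mem_Icc.2 zero_le_one) zero_le_one
  have e0 : G 0 = f 0 := by simp [G, F, L]
  rw [e0] at hfin
  have e1 : F 1 ≤ f 0 * Real.exp (√B * L 1) := by
    have := mul_le_mul_of_nonneg_right hfin (Real.exp_pos (√B * L 1)).le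
    simp only [G] at this
    rwa [mul_assoc, ← Real.exp_add, neg_add_cancel, Real.exp_zero, mul_one] at this
  have e2 := hfF 1 zero_le_one
  simp only [f, h0, h1] at e1 e2
  refine (e2.trans e1).trans ?_
  have := rdist_nonneg g x₀ x
  have hl' : L 1 ≤ r := hl.le
  gcongr

theorem isCompleteMetric_conformalMetric [WeaklyLocallyCompactSpace S] (hg : IsCompleteMetric g)
    (hq : AtMostQuadratic g β) : IsCompleteMetric (conformalMetric g β hβ hpos) := by
  intro u hu
  have hu' := cauchySeq_of_riemannianDist hu
  obtain ⟨x₀, A, K, hA, hK, hAK⟩ := hq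
  obtain ⟨b, hb⟩ := hK.bddAbove_image hβ.continuous.continuousOn
  -- Adding `1` to the distance absorbs the compact set `K`, where `β` is only known to be bounded
  -- by `b`.
  have hβB : ∀ x, β x ≤ max A b * (1 + rdist g x₀ x) ^ 2 := by
    intro x
    have hd := rdist_nonneg g x₀ x
    have hm : 0 < max A b := hA.trans_le (le_max_left _ _)
    by_cases hx : x ∈ K
    · calc β x ≤ max A b := (hb ⟨x, hx, rfl⟩).trans (le_max_right _ _)
        _ ≤ _ := le_mul_of_one_le_right hm.le (one_le_pow₀ (by linarith))
    · calc β x ≤ A * rdist g x₀ x ^ 2 := hAK x hx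
        _ ≤ _ := by
          gcongr
          · exact le_max_left _ _
          · linarith
  obtain ⟨N, hN⟩ := exists_forall_ge_rdist_lt _ hu' one_pos
  have hcompact : IsCompact {y | rdist g y x₀ ≤
      (1 + rdist g x₀ (u N)) * Real.exp (√(max A b) * 1)} := by
    let _ := metricSpaceOf g
    have := completeSpace_of_isCompleteMetric hg
    exact (hasShortPaths g).isCompact_closedBall x₀ _
  refine tendsto_of_cauchySeq_of_isCompact _ hu' hcompact (N := N) fun n hn ↦ ?_
  have := one_add_rdist_le_of_rdist_conformalMetric_lt (hA.le.trans (le_max_left _ _)) hβB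
    (hN N le_rfl n hn)
  rw [mem_ofPred_eq, rdist_comm]
  linarith

end completeness

/-! ### The causal relation when balls are compact, and global hyperbolicity -/

section globallyHyperbolic

variable {E : Type*} [NormedAddCommGroup E] [NormedSpace ℝ E] [FiniteDimensional ℝ E]
  {S : Type*} [TopologicalSpace S] [ChartedSpace E S] [IsManifold 𝓘(ℝ, E) ∞ S]
  [T3Space S] [ConnectedSpace S] {g : SmoothRiemannianMetric 𝓘(ℝ, E) S} {β : S → ℝ}
  {hβ : ContMDiff 𝓘(ℝ, E) 𝓘(ℝ, ℝ) ∞ β} {hpos : ∀ x, 0 < β x}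

theorem isCausalCurve_of_rdist_le {σ : ℝ → S} {a b : ℝ}
    (hσ : ContMDiffOn 𝓘(ℝ, ℝ) 𝓘(ℝ, E) 1 σ (Icc a b))
    (hd : ∀ s ∈ Icc a b, ∀ t ∈ Icc a b,
      rdist (conformalMetric g β hβ hpos) (σ s) (σ t) ≤ |t - s|) (t₀ : ℝ) :
    (standardStatic g β hβ hpos).IsCausalCurve (fun s ↦ (t₀ + s, σ s)) (Icc a b) := by
  have ht : ContDiff ℝ 1 (fun s : ℝ ↦ t₀ + s) := by fun_prop
  have hγ : ContMDiffOn 𝓘(ℝ, ℝ) (𝓘(ℝ, ℝ).prod 𝓘(ℝ, E)) 1 (fun s ↦ (t₀ + s, σ s)) (Icc a b) :=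
    ht.contMDiff.contMDiffOn.prodMk hσ
  refine Spacetime.isPiecewiseCurve_of_contMDiffOn ordConnected_Icc hγ
    fun c hc d hd' hcd s hs ↦ ?_
  have hsub : Icc c d ⊆ Icc a b := Icc_subset_Icc hc.1 hd'.2
  have hu := uniqueDiffOn_Icc hcd s hs
  have hder : derivWithin (fun s ↦ t₀ + s) (Icc c d) s = 1 :=
    ((hasDerivAt_id s).const_add t₀).hasDerivWithinAt.derivWithin hu
  rw [futureCausal_velocity_iff ((hγ.mono hsub).mdifferentiableOn one_ne_zero s hs) hu]
  simp only [hder]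
  exact ⟨one_pos, speed_le_one_of_rdist_le hcd (hσ.mono hsub)
    (fun s hs t ht ↦ hd s (hsub hs) t (hsub ht)) hs⟩

/-- Only equality goes beyond `chronological_iff`. There the minimizing path, parametrized by
distance and lifted at unit time rate, is causal because its speed is at most `1`; regularity is
checked locally in charts. -/
theorem causal_of_rdist_le (hc : ∀ x r, IsCompact {y | rdist (conformalMetric g β hβ hpos) y x ≤ r})
    {p q : ℝ × S} (h : rdist (conformalMetric g β hβ hpos) p.2 q.2 ≤ q.1 - p.1) :
    (standardStatic g β hβ hpos).Causal p q := by
  rcases h.lt_or_eq with h | h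
  · exact causal_of_rdist_lt h
  set gc := conformalMetric g β hβ hpos with hgc
  set ℓ := rdist gc p.2 q.2 with hℓ
  rcases (rdist_nonneg gc p.2 q.2).eq_or_lt with h0 | h0
  · refine Or.inl (Prod.ext (by linarith) (eq_of_rdist_le_zero gc h0.symm.le))
  obtain ⟨σ, hσ0, hσ1, hσ⟩ := @HasShortPaths.exists_isometric_path S (metricSpaceOf gc)
    (hasShortPaths gc) p.2 q.2 (hc _ _)
  change σ ℓ = q.2 at hσ1
  have hσ' : ∀ s t, 0 ≤ s → s ≤ t → t ≤ ℓ → rdist gc (σ s) (σ t) = t - s := hσ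
  have habs : ∀ s ∈ Icc 0 ℓ, ∀ t ∈ Icc 0 ℓ, rdist gc (σ s) (σ t) = |t - s| := by
    intro s hs t ht
    rcases le_total s t with hst | hst
    · rw [hσ' s t hs.1 hst ht.2, abs_of_nonneg (sub_nonneg.2 hst)]
    · rw [rdist_comm, hσ' t s ht.1 hst hs.2, abs_of_nonpos (sub_nonpos.2 hst), neg_sub]
  refine Or.inr ⟨fun s ↦ (p.1 + s, σ s), 0, ℓ, h0, ?_, by simp [hσ0], Prod.ext ?_ hσ1⟩
  · refine Spacetime.isPiecewiseCurve_of_locally h0.le fun s₀ hs₀ ↦ ?_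
    obtain ⟨ρ, m, C, r, hB⟩ := exists_chartBounds gc (σ s₀)
    refine ⟨r, hB.r_pos, fun a b ha hab hb har hbr ↦ ?_⟩
    have hsub : Icc a b ⊆ Icc 0 ℓ := Icc_subset_Icc ha hb
    obtain ⟨h1, h2⟩ := hB.contMDiffOn_of_isometric hab
      (fun s t hs hst ht ↦ hσ' s t (ha.trans hs) hst (ht.trans hb)) fun s hs ↦ by
        rw [habs s₀ hs₀ s (hsub hs), abs_lt]
        exact ⟨by linarith [hs.1], by linarith [hs.2]⟩
    have hs1 : Icc a ((a + b) / 2) ⊆ Icc 0 ℓ := Icc_subset_Icc ha (by linarith)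
    have hs2 : Icc ((a + b) / 2) b ⊆ Icc 0 ℓ := Icc_subset_Icc (by linarith) hb
    exact Spacetime.IsPiecewiseCurve.union (b := (a + b) / 2) (by linarith) (by linarith)
      (isCausalCurve_of_rdist_le h1 (fun s hs t ht ↦ (habs s (hs1 hs) t (hs1 ht)).le) p.1)
      (isCausalCurve_of_rdist_le h2 (fun s hs t ht ↦ (habs s (hs2 hs) t (hs2 ht)).le) p.1)
  · change p.1 + ℓ = q.1
    linarith

/-- Since the causal relation is now the closed condition `d(p.2, q.2) ≤ q.1 - p.1`, a diamond is a
closed subset of a time interval times a compact ball. -/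
theorem isGloballyHyperbolic_of_isCompleteMetric
    (h : IsCompleteMetric (conformalMetric g β hβ hpos)) :
    (standardStatic g β hβ hpos).IsGloballyHyperbolic := by
  have := ChartedSpace.locallyCompactSpace E S
  have hc : ∀ x r, IsCompact {y | rdist (conformalMetric g β hβ hpos) y x ≤ r} := by
    intro x r
    let _ := metricSpaceOf (conformalMetric g β hβ hpos)
    have := completeSpace_of_isCompleteMetric h
    exact (hasShortPaths (conformalMetric g β hβ hpos)).isCompact_closedBall x r
  refine ⟨isStronglyCausal, fun p q ↦ ?_⟩
  have heq : (standardStatic g β hβ hpos).causalFuture p ∩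
      (standardStatic g β hβ hpos).causalPast q =
      {z | rdist (conformalMetric g β hβ hpos) p.2 z.2 ≤ z.1 - p.1} ∩
      {z | rdist (conformalMetric g β hβ hpos) z.2 q.2 ≤ q.1 - z.1} :=
    Set.ext fun z ↦ ⟨fun hz ↦ ⟨rdist_le_of_causal hz.1, rdist_le_of_causal hz.2⟩,
      fun hz ↦ ⟨causal_of_rdist_le hc hz.1, causal_of_rdist_le hc hz.2⟩⟩
  rw [heq]
  refine ((isCompact_Icc (a := p.1) (b := q.1)).prod (hc p.2 (q.1 - p.1))).of_isClosed_subset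
    (IsClosed.inter ?_ ?_) fun z hz ↦ ?_
  · exact isClosed_le ((continuous_rdist_snd _).comp (Continuous.prodMk_right p)) (by fun_prop)
  · exact isClosed_le ((continuous_rdist_snd _).comp (Continuous.prodMk_left q)) (by fun_prop)
  · have h1 : rdist (conformalMetric g β hβ hpos) p.2 z.2 ≤ z.1 - p.1 := hz.1
    have h2 : rdist (conformalMetric g β hβ hpos) z.2 q.2 ≤ q.1 - z.1 := hz.2
    have h3 := rdist_nonneg (conformalMetric g β hβ hpos) p.2 z.2
    have h4 := rdist_nonneg (conformalMetric g β hβ hpos) z.2 q.2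
    refine ⟨⟨by linarith, by linarith⟩, ?_⟩
    rw [mem_ofPred_eq, rdist_comm]
    linarith

end globallyHyperbolic
end StaticSpacetime

open StaticSpacetime
theorem theorem3p1 {n : ℕ} {S : Type*} [TopologicalSpace S] [T2Space S]
    [SecondCountableTopology S] [ConnectedSpace S] [ChartedSpace (EuclideanSpace ℝ (Fin n)) S]
    [IsManifold (𝓡 n) ∞ S] (gS : SmoothRiemannianMetric (𝓡 n) S) (β : S → ℝ)
    (hβ : ContMDiff (𝓡 n) 𝓘(ℝ, ℝ) ∞ β) (hpos : ∀ x, 0 < β x) :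
    (standardStatic gS β hβ hpos).IsCausallyContinuous ∧
    [(standardStatic gS β hβ hpos).IsGloballyHyperbolic,
      IsCompleteMetric (conformalMetric gS β hβ hpos),
      ∀ c : ℝ, (standardStatic gS β hβ hpos).IsCauchyHypersurface
        {p : ℝ × S | p.1 = c}].TFAE ∧
    (IsCompleteMetric gS → AtMostQuadratic gS β →
      (standardStatic gS β hβ hpos).IsGloballyHyperbolic ∧
      IsCompleteMetric (conformalMetric gS β hβ hpos) ∧
      ∀ c : ℝ, (standardStatic gS β hβ hpos).IsCauchyHypersurface {p : ℝ × S | p.1 = c}) := by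
  have := ChartedSpace.locallyCompactSpace (EuclideanSpace ℝ (Fin n)) S
  refine ⟨isCausallyContinuous, ?_, fun hg hq ↦ ?_⟩
  · tfae_have 1 → 2 := isCompleteMetric_of_isGloballyHyperbolic
    tfae_have 2 → 1 := isGloballyHyperbolic_of_isCompleteMetric
    tfae_have 2 → 3 := isCauchyHypersurface_of_isCompleteMetric
    tfae_have 3 → 2 := isCompleteMetric_of_isCauchyHypersurface
    tfae_finish
  · have hc := isCompleteMetric_conformalMetric (hβ := hβ) (hpos := hpos) hg hq
    exact ⟨isGloballyHyperbolic_of_isCompleteMetric hc, hc,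
      isCauchyHypersurface_of_isCompleteMetric hc⟩
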